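/- Let $(\mathbb X,\mathcal X)$ be a measurable space with a $\sigma$-finite measure $\lambda$, and for every $t>0$ let $\eta_t$ be a Poisson process on $\mathbb X$ with intensity measure $t\lambda$, all defined on one probability space, i.e. a random integer-valued (including $+\infty$) $\sigma$-finite measure such that $\eta_t(B)$ is Poisson distributed with mean $t\lambda(B)$ (a.s. infinite if $\lambda(B)=\infty$) and is independent over finitely many pairwise disjoint measurable sets. For an integer-valued $\sigma$-finite measure $\mu$ and $m\ge 1$ let $\mu^{(m)}$ be its $m$-th factorial measure on $\mathbb X^m$, given by $\mu^{(1)}=\mu$ and $$\mu^{(m+1)}(B)=\int\Big(\int \mathbf 1_B(x_1,\dots,x_m,y)\,\mu(dy)-\sum_{j=1}^m\mathbf 1_B(x_1,\dots,x_m,x_j)\Big)\,\mu^{(m)}(d(x_1,\dots,x_m));$$ if $\mu=\sum_i\delta_{x_i}$ it sums over $m$-tuples of points with pairwise distinct indices. Let $m\ge1$, let $f:\mathbb X^m\to\mathbb R$ be measurable, symmetric and $\lambda^m$-integrable, and let $g:(0,\infty)\to\mathbb R$ satisfy $g(t)\neq0$ for all sufficiently large $t$. Put $$F_t:=g(t)\int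 f\,d\eta_t^{(m)},\qquad f_1(x):=m\int f(x,y_1,\dots,y_{m-1})\,\lambda^{m-1}(d(y_1,\dots,y_{m-1})).$$ Let $\ell\ge1$ be an integer. Let $\Pi(m,\dots,m)$ be the set of partitions $\sigma$ of $\{1,\dots,\ell\}\times\{1,\dots,m\}$ each of whose blocks contains at most one element of each row $\{i\}\times\{1,\dots,m\}$. For such $\sigma$ let $(|f|^{\otimes\ell})_\sigma$ be the function of $|\sigma|$ variables (one per block) obtained from $\prod_{i=1}^{\ell}|f(x_{i,1},\dots,x_{i,m})|$ by identifying the variables whose indices lie in the same block. Assume that $$\int(|f|^{\otimes\ell})_\sigma\,d\lambda^{|\sigma|}<\infty\quad\text{for all }\sigma\in\Pi(m,\dots,m),$$ and that the $L^2(\lambda)$-norm of $f_1$ is positive. Then, for every $t>0$, $f$ is almost surely $\eta_t^{(m)}$-integrable and $\mathbb E|F_t|^\ell<\infty$; if $\ell\ge2$, then $\mathbb V[F_t]>0$ for all sufficiently large $t$; and $$\lim_{t\to\infty}\frac{\mathbb E(F_t-\mathbb EF_t)^\ell}{(\mathbb V[F_t])^{\ell/2}}=\begin{cases}(\ell-1)!!,&\ell\text{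 even},\\0,&\ell\text{ odd},\end{cases}\qquad \lim_{t\to\infty}\gamma_\ell\left(\frac{F_t-\mathbb EF_t}{\sqrt{\mathbb V[F_t]}}\right)=\begin{cases}1,&\ell=2,\\0,&\ell\neq2.\end{cases}$$ Here $(\ell-1)!!=(\ell-1)(\ell-3)\cdots3\cdot1$ for even $\ell$, and $\gamma_\ell(Y)=\gamma(Y,\dots,Y)$ ($\ell$ entries), where $$\gamma(Y_1,\dots,Y_\ell)=(-\mathbf i)^\ell\frac{\partial^\ell}{\partial z_1\cdots\partial z_\ell}\log\mathbb E\exp\big(\mathbf i(z_1Y_1+\dots+z_\ell Y_\ell)\big)\Big|_{z_1=\dots=z_\ell=0}$$ is the joint cumulant. (For $\ell=1$ the variance may be infinite; the quotients are then read as $0$.) -/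

import Mathlib

open MeasureTheory ProbabilityTheory Filter
open scoped ENNReal Topology

namespace PoissonU

/-- All values of `μ` on measurable sets lie in `{0, 1, 2, …} ∪ {∞}`. -/
def IsIntegerValued {X : Type*} [MeasurableSpace X] (μ : Measure X) : Prop :=
  ∀ B, MeasurableSet B → ∃ k : ℕ∞, μ B = (k : ℝ≥0∞)

open Classical in
/-- The factorial measure `μ^(m)` on `X^m`, by recursion on `m`:
`μ^(m+1)(B) = ∫ (μ - ∑ j, δ_{x_j}) {y | (x_1, …, x_m, y) ∈ B} μ^(m)(d(x_1, …, x_m))`,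
where `δ_{x_j} {y | (x, y) ∈ B}` is the indicator of `(x_1, …, x_m, x_j) ∈ B`. For every
integer-valued `σ`-finite `μ` such a measure on `X^(m+1)` exists (it is then unique): see
`factorialMeasure_succ_apply`. If `μ = ∑ i, δ_{x_i}`, then `μ^(m)` is the sum of the Dirac measures
at the tuples `(x_{i_1}, …, x_{i_m})` with pairwise distinct indices: see
`factorialMeasure_sum_dirac`. -/
noncomputable def factorialMeasure {X : Type*} [MeasurableSpace X] (μ : Measure X) :
    (m : ℕ) → Measure (Fin m → X)
  | 0 => Measure.dirac Fin.elim0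
  | m + 1 =>
    if h : ∃ ν : Measure (Fin (m + 1) → X), ∀ B, MeasurableSet B →
        ν B = ∫⁻ x : Fin m → X, (μ {y | (Fin.snoc x y : Fin (m + 1) → X) ∈ B}
          - ∑ j : Fin m, B.indicator 1 (Fin.snoc x (x j) : Fin (m + 1) → X))
          ∂(factorialMeasure μ m)
    then h.choose
    else 0

/-- Auxiliary: `κ` takes only the values `0` and `1` on measurable sets. -/
def IsZeroOne {X : Type*} [MeasurableSpace X] (κ : Measure X) : Prop :=
  ∀ B, MeasurableSet B → κ B = 0 ∨ κ B = 1

theorem exists_zeroOne_fin {X : Type*} [MeasurableSpace X] (n : ℕ) :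
    ∀ μ : Measure X, IsIntegerValued μ → μ Set.univ = n →
      ∃ (ι : Type) (_ : Countable ι) (κ : ι → Measure X),
        (∀ i, IsZeroOne (κ i)) ∧ μ = Measure.sum κ := by
  induction n using Nat.strong_induction_on with
  | _ n ih =>
  intro μ hμ hn
  rcases Nat.eq_zero_or_pos n with h0 | hpos
  · refine ⟨Empty, inferInstance, fun i => i.elim, fun i => i.elim, ?_⟩
    subst h0
    have : μ = 0 := by simpa using hn
    subst this
    ext s hs
    simp
  have hex : ∃ p : ℕ, 0 < p ∧ ∃ A, MeasurableSet A ∧ μ A = p :=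
    ⟨n, hpos, Set.univ, MeasurableSet.univ, hn⟩
  classical
  obtain ⟨hp, A, hA, hAp⟩ := Nat.find_spec hex
  set p := Nat.find hex with hpdef
  have hmin : ∀ q : ℕ, 0 < q → (∃ A, MeasurableSet A ∧ μ A = q) → p ≤ q :=
    fun q h1 h2 => Nat.find_min' hex ⟨h1, h2⟩
  have hfin : ∀ B, MeasurableSet B → ∃ k : ℕ, μ B = k := by
    intro B hB
    obtain ⟨k, hk⟩ := hμ B hB
    have : μ B ≤ n := hn ▸ measure_mono (Set.subset_univ _)
    have hk' : k ≠ ⊤ := by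
      rintro rfl
      rw [hk] at this
      simp at this
    lift k to ℕ using hk'
    exact ⟨k, by simpa using hk⟩
  have hAB : ∀ B, MeasurableSet B → μ (B ∩ A) = 0 ∨ μ (B ∩ A) = p := by
    intro B hB
    obtain ⟨k, hk⟩ := hfin _ (hB.inter hA)
    rcases Nat.eq_zero_or_pos k with h | h
    · left; simp [hk, h]
    · right
      have h1 := hmin k h ⟨_, hB.inter hA, hk⟩
      have h2 : (k : ℝ≥0∞) ≤ p := by
        rw [← hk, ← hAp]; exact measure_mono Set.inter_subset_right
      have h3 : k ≤ p := by exact_mod_cast h2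
      rw [hk, le_antisymm h3 h1]
  have hp0 : (p : ℝ≥0∞) ≠ 0 := by exact_mod_cast hp.ne'
  have hpt : (p : ℝ≥0∞) ≠ ⊤ := ENNReal.natCast_ne_top p
  let κ0 : Measure X := (p : ℝ≥0∞)⁻¹ • μ.restrict A
  have hκ0 : IsZeroOne κ0 := by
    intro B hB
    simp only [κ0, Measure.smul_apply, Measure.restrict_apply hB, smul_eq_mul]
    rcases hAB B hB with h | h
    · left; simp [h]
    · right; rw [h]; exact ENNReal.inv_mul_cancel hp0 hpt
  obtain ⟨k, hk⟩ := hfin Aᶜ hA.compl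
  have hkn : k < n := by
    have : μ A + μ Aᶜ = μ Set.univ := measure_add_measure_compl hA
    rw [hAp, hk, hn] at this
    have : p + k = n := by exact_mod_cast this
    omega
  obtain ⟨ι, hι, κ, hκ, hsum⟩ := ih k hkn (μ.restrict Aᶜ)
    (fun B hB => by rw [Measure.restrict_apply hB]; exact hμ _ (hB.inter hA.compl))
    (by simpa using hk)
  refine ⟨Fin p ⊕ ι, inferInstance, Sum.elim (fun _ => κ0) κ, ?_, ?_⟩
  · rintro (i | i)
    · exact hκ0
    · exact hκ i
  · ext B hB
    rw [Measure.sum_apply _ hB, ENNReal.summable.tsum_sum ENNReal.summable]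
    have h1 : μ B = μ.restrict A B + μ.restrict Aᶜ B := by
      rw [← Measure.add_apply, Measure.restrict_add_restrict_compl hA]
    have h2 : ∑' i, κ i B = μ.restrict Aᶜ B := by rw [hsum, Measure.sum_apply _ hB]
    simp only [Sum.elim_inl, Sum.elim_inr]
    rw [h2, h1, tsum_fintype]
    simp only [κ0, Measure.smul_apply, smul_eq_mul, Finset.sum_const, Finset.card_univ,
      Fintype.card_fin, nsmul_eq_mul]
    rw [← mul_assoc, ENNReal.mul_inv_cancel hp0 hpt, one_mul]

theorem exists_zeroOne {X : Type*} [MeasurableSpace X] (μ : Measure X) [SigmaFinite μ]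
    (hμ : IsIntegerValued μ) :
    ∃ (ι : Type) (_ : Countable ι) (κ : ι → Measure X),
      (∀ i, IsZeroOne (κ i)) ∧ μ = Measure.sum κ := by
  have key : ∀ n : ℕ, ∃ (ι : Type) (_ : Countable ι) (κ : ι → Measure X),
      (∀ i, IsZeroOne (κ i)) ∧
        μ.restrict (disjointed (spanningSets μ) n) = Measure.sum κ := by
    intro n
    have hm : MeasurableSet (disjointed (spanningSets μ) n) :=
      MeasurableSet.disjointed (measurableSet_spanningSets μ) n
    obtain ⟨k, hk⟩ := hμ _ hm
    have hlt : μ (disjointed (spanningSets μ) n) < ⊤ :=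
      (measure_mono (disjointed_subset _ _)).trans_lt (measure_spanningSets_lt_top μ n)
    have hk' : k ≠ ⊤ := by
      rintro rfl
      rw [hk] at hlt
      simp at hlt
    lift k to ℕ using hk'
    refine exists_zeroOne_fin k _ (fun B hB => ?_) (by simpa using hk)
    rw [Measure.restrict_apply hB]
    exact hμ _ (hB.inter hm)
  choose ι hι κ hκ hsum using key
  refine ⟨Σ n, ι n, inferInstance, fun p => κ p.1 p.2, fun p => hκ _ _, ?_⟩
  ext B hB
  conv_lhs => rw [← sum_restrict_disjointed_spanningSets μ μ]
  rw [Measure.sum_apply _ hB, Measure.sum_apply _ hB, ENNReal.tsum_sigma']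
  refine tsum_congr fun n => ?_
  rw [hsum, Measure.sum_apply _ hB]

theorem IsZeroOne.isFiniteMeasure {X : Type*} [MeasurableSpace X] {κ : Measure X}
    (h : IsZeroOne κ) : IsFiniteMeasure κ :=
  ⟨by rcases h _ MeasurableSet.univ with h | h <;> simp [h]⟩

theorem IsZeroOne.inter {X : Type*} [MeasurableSpace X] {κ : Measure X}
    (h : IsZeroOne κ) {s t : Set X} (hs : MeasurableSet s) (ht : MeasurableSet t) :
    κ (s ∩ t) = κ s * κ t := by
  have := h.isFiniteMeasure
  rcases h s hs with h1 | h1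
  · rw [h1, zero_mul]
    exact measure_mono_null Set.inter_subset_left h1
  rcases h t ht with h2 | h2
  · rw [h2, mul_zero]
    exact measure_mono_null Set.inter_subset_right h2
  rw [h1, h2, one_mul]
  have hu : κ Set.univ = 1 := by
    rcases h _ MeasurableSet.univ with h3 | h3
    · have := measure_mono_null (Set.subset_univ s) h3
      simp [this] at h1
    · exact h3
  have htc : κ tᶜ = 0 := by
    rw [measure_compl ht (by simp [h2]), hu, h2]; simp
  rw [measure_inter_conull htc, h1]

theorem measurable_snoc {X : Type*} [MeasurableSpace X] {m : ℕ} :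
    Measurable (fun p : (Fin m → X) × X => (Fin.snoc p.1 p.2 : Fin (m + 1) → X)) := by
  refine measurable_pi_lambda _ fun i => ?_
  refine Fin.lastCases ?_ (fun j => ?_) i
  · simpa using measurable_snd
  · simpa using! (measurable_pi_apply j).comp measurable_fst

theorem pi_snoc_apply {X : Type*} [MeasurableSpace X] {m : ℕ} (μ : Fin m → Measure X)
    (κ : Measure X) [∀ j, IsFiniteMeasure (μ j)] [IsFiniteMeasure κ]
    {B : Set (Fin (m + 1) → X)} (hB : MeasurableSet B) :
    Measure.pi (Fin.snoc μ κ : Fin (m + 1) → Measure X) B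
      = ∫⁻ x, κ {y | (Fin.snoc x y : Fin (m + 1) → X) ∈ B} ∂(Measure.pi μ) := by
  have hinst : ∀ i, IsFiniteMeasure ((Fin.snoc μ κ : Fin (m + 1) → Measure X) i) := by
    intro i
    refine Fin.lastCases ?_ (fun j => ?_) i
    · simpa
    · simpa using (inferInstance : IsFiniteMeasure (μ j))
  have : Measure.pi (Fin.snoc μ κ : Fin (m + 1) → Measure X)
      = ((Measure.pi μ).prod κ).map (fun p => (Fin.snoc p.1 p.2 : Fin (m + 1) → X)) := by
    refine Measure.pi_eq fun s hs => ?_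
    rw [Measure.map_apply measurable_snoc (MeasurableSet.univ_pi hs)]
    have hpre : (fun p : (Fin m → X) × X => (Fin.snoc p.1 p.2 : Fin (m + 1) → X)) ⁻¹'
        (Set.univ.pi s) = (Set.univ.pi fun j : Fin m => s j.castSucc) ×ˢ (s (Fin.last m)) := by
      ext p
      simp [Set.mem_pi, Fin.forall_fin_succ']
    rw [hpre, Measure.prod_prod, Measure.pi_pi, Fin.prod_univ_castSucc]
    simp
  rw [this, Measure.map_apply measurable_snoc hB, Measure.prod_apply (measurable_snoc hB)]
  rfl

theorem map_snoc_self {X : Type*} [MeasurableSpace X] {m : ℕ} (μ : Fin m → Measure X)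
    (h : ∀ j, IsZeroOne (μ j)) [∀ j, IsFiniteMeasure (μ j)] (j : Fin m) :
    (Measure.pi μ).map (fun x => (Fin.snoc x (x j) : Fin (m + 1) → X))
      = Measure.pi (Fin.snoc μ (μ j) : Fin (m + 1) → Measure X) := by
  have hinst : ∀ i, IsFiniteMeasure ((Fin.snoc μ (μ j) : Fin (m + 1) → Measure X) i) := by
    intro i
    refine Fin.lastCases ?_ (fun j => ?_) i
    · simpa using (inferInstance : IsFiniteMeasure (μ j))
    · simpa using (inferInstance : IsFiniteMeasure (μ j))
  have hm : Measurable (fun x : Fin m → X => (Fin.snoc x (x j) : Fin (m + 1) → X)) :=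
    measurable_snoc.comp (measurable_id.prodMk (measurable_pi_apply j))
  symm
  refine Measure.pi_eq fun s hs => ?_
  rw [Measure.map_apply hm (MeasurableSet.univ_pi hs)]
  have hpre : (fun x : Fin m → X => (Fin.snoc x (x j) : Fin (m + 1) → X)) ⁻¹'
      (Set.univ.pi s) = Set.univ.pi (Function.update (fun k : Fin m => s k.castSucc) j
        (s j.castSucc ∩ s (Fin.last m))) := by
    ext x
    simp only [Set.mem_preimage, Set.mem_pi, Set.mem_univ, forall_const, Fin.forall_fin_succ',
      Fin.snoc_castSucc, Fin.snoc_last]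
    constructor
    · rintro ⟨h1, h2⟩ k
      by_cases hk : k = j
      · subst hk; simp [h1, h2]
      · simp [Function.update_of_ne hk, h1]
    · intro h1
      have hj := h1 j
      simp only [Function.update_self] at hj
      refine ⟨fun k => ?_, hj.2⟩
      by_cases hk : k = j
      · subst hk; exact hj.1
      · simpa [Function.update_of_ne hk] using h1 k
  rw [hpre, Measure.pi_pi, Fin.prod_univ_castSucc]
  simp only [Fin.snoc_castSucc, Fin.snoc_last]
  rw [← Finset.mul_prod_erase _ _ (Finset.mem_univ j),
    ← Finset.mul_prod_erase (a := j) Finset.univ (fun k => μ k (s k.castSucc)) (Finset.mem_univ j)]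
  rw [Function.update_self, (h j).inter (hs _) (hs _)]
  rw [Finset.prod_congr rfl (g := fun k => μ k (s k.castSucc))]
  · ring
  · intro k hk
    rw [Function.update_of_ne (Finset.ne_of_mem_erase hk)]

theorem section_ae_eq {X : Type*} [MeasurableSpace X] {m : ℕ} (μ : Fin m → Measure X)
    (h : ∀ j, IsZeroOne (μ j)) [∀ j, IsFiniteMeasure (μ j)] (j : Fin m)
    {B : Set (Fin (m + 1) → X)} (hB : MeasurableSet B) :
    ∀ᵐ x ∂(Measure.pi μ), μ j {y | (Fin.snoc x y : Fin (m + 1) → X) ∈ B}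
      = B.indicator 1 (Fin.snoc x (x j) : Fin (m + 1) → X) := by
  have hm : Measurable (fun x : Fin m → X => (Fin.snoc x (x j) : Fin (m + 1) → X)) :=
    measurable_snoc.comp (measurable_id.prodMk (measurable_pi_apply j))
  have hsec : ∀ C : Set (Fin (m + 1) → X), MeasurableSet C → ∀ x : Fin m → X,
      MeasurableSet {y | (Fin.snoc x y : Fin (m + 1) → X) ∈ C} := fun C hC x =>
    (measurable_snoc.comp (measurable_const.prodMk measurable_id)) hC
  have key : ∀ C : Set (Fin (m + 1) → X), MeasurableSet C →
      (∀ x : Fin m → X, μ j {y | (Fin.snoc x y : Fin (m + 1) → X) ∈ C} = 0) →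
      ∀ᵐ x ∂(Measure.pi μ), (Fin.snoc x (x j) : Fin (m + 1) → X) ∉ C := by
    intro C hC h0
    have h1 := pi_snoc_apply μ (μ j) hC
    rw [← map_snoc_self μ h j, Measure.map_apply hm hC] at h1
    simp only [h0, lintegral_zero] at h1
    exact measure_eq_zero_iff_ae_notMem.1 h1
  let u : (Fin m → X) → ℝ≥0∞ := fun x => μ j {y | (Fin.snoc x y : Fin (m + 1) → X) ∈ B}
  have hu : Measurable u := measurable_measure_prodMk_left (measurable_snoc hB)
  let r : (Fin (m + 1) → X) → (Fin m → X) := fun z k => z k.castSucc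
  have hr : Measurable r := measurable_pi_lambda _ fun k => measurable_pi_apply _
  have hrs : ∀ (x : Fin m → X) (y : X), r (Fin.snoc x y : Fin (m + 1) → X) = x := by
    intro x y; ext k; simp [r]
  have hU : MeasurableSet (r ⁻¹' (u ⁻¹' {0})) := hr (hu (measurableSet_singleton 0))
  have k1 := key (B ∩ r ⁻¹' (u ⁻¹' {0})) (hB.inter hU) (by
    intro x
    by_cases hx : u x = 0
    · exact measure_mono_null (fun y hy => hy.1) hx
    · convert measure_empty (μ := μ j) using 2
      ext y; simp [hrs, hx])
  have k2 := key (Bᶜ ∩ (r ⁻¹' (u ⁻¹' {0}))ᶜ) (hB.compl.inter hU.compl) (by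
    intro x
    by_cases hx : u x = 0
    · convert measure_empty (μ := μ j) using 2
      ext y; simp [hrs, hx]
    · refine measure_mono_null (t := {y | (Fin.snoc x y : Fin (m + 1) → X) ∈ B}ᶜ)
        (fun y hy => hy.1) ?_
      rcases h j _ (hsec B hB x) with h1 | h1
      · exact absurd h1 hx
      · have hun : μ j Set.univ = 1 := by
          rcases h j _ MeasurableSet.univ with h3 | h3
          · rw [measure_mono_null (Set.subset_univ _) h3] at h1; simp at h1
          · exact h3
        rw [measure_compl (hsec B hB x) (by simp [h1]), hun, h1]; simp)
  filter_upwards [k1, k2] with x hx1 hx2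
  simp only [Set.mem_inter_iff, Set.mem_preimage, hrs, Set.mem_singleton_iff, Set.mem_compl_iff,
    not_and, not_not] at hx1 hx2
  change u x = _
  by_cases hb : (Fin.snoc x (x j) : Fin (m + 1) → X) ∈ B
  · rw [Set.indicator_of_mem hb]
    rcases h j _ (hsec B hB x) with h1 | h1
    · exact absurd h1 (hx1 hb)
    · exact h1
  · rw [Set.indicator_of_notMem hb]
    exact hx2 hb


theorem snocEmbedding_bijective (m : ℕ) (ι : Type) :
    Function.Bijective (fun p : Σ e : Fin m ↪ ι, {k // k ∉ Set.range e} =>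
      (⟨Fin.snoc p.1 p.2.1, Fin.snoc_injective_of_injective p.1.injective p.2.2⟩ :
        Fin (m + 1) ↪ ι)) := by
  constructor
  · rintro ⟨e, k, hk⟩ ⟨e', k', hk'⟩ h
    have h' : (Fin.snoc e k : Fin (m + 1) → ι) = Fin.snoc e' k' := congrArg DFunLike.coe h
    obtain ⟨h1, h2⟩ := Fin.snoc_inj.1 h'
    have h3 : e = e' := DFunLike.coe_injective h1
    subst h3
    subst h2
    rfl
  · intro e
    refine ⟨⟨⟨fun k => e k.castSucc, fun a b hab => by simpa using hab⟩, ⟨e (Fin.last m), ?_⟩⟩, ?_⟩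
    · rintro ⟨k, hk⟩
      exact absurd (e.injective hk) (Fin.castSucc_lt_last k).ne
    · ext k
      refine Fin.lastCases ?_ (fun j => ?_) k
      · simp
      · simp only [Function.Embedding.coeFn_mk, Fin.snoc_castSucc]
        rfl

theorem lintegral_sum_eq {X : Type*} [MeasurableSpace X] {ι : Type} [Countable ι]
    (κ : ι → Measure X) (hκ : ∀ i, IsZeroOne (κ i)) (m : ℕ)
    {B : Set (Fin (m + 1) → X)} (hB : MeasurableSet B) :
    Measure.sum (fun e : Fin (m + 1) ↪ ι => Measure.pi fun j => κ (e j)) B =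
      ∫⁻ x : Fin m → X, (Measure.sum κ {y | (Fin.snoc x y : Fin (m + 1) → X) ∈ B}
          - ∑ j : Fin m, B.indicator 1 (Fin.snoc x (x j) : Fin (m + 1) → X))
          ∂(Measure.sum fun e : Fin m ↪ ι => Measure.pi fun j => κ (e j)) := by
  classical
  have hfin : ∀ i, IsFiniteMeasure (κ i) := fun i => (hκ i).isFiniteMeasure
  rw [lintegral_sum_measure, Measure.sum_apply _ hB,
    ← (Equiv.ofBijective _ (snocEmbedding_bijective m ι)).tsum_eq, ENNReal.tsum_sigma']
  refine tsum_congr fun e => ?_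
  have h1 : ∀ᵐ x ∂(Measure.pi fun j => κ (e j)), ∀ j : Fin m,
      κ (e j) {y | (Fin.snoc x y : Fin (m + 1) → X) ∈ B}
        = B.indicator 1 (Fin.snoc x (x j) : Fin (m + 1) → X) :=
    ae_all_iff.2 fun j => section_ae_eq (fun j => κ (e j)) (fun j => hκ _) j hB
  have h2 : ∀ᵐ x ∂(Measure.pi fun j => κ (e j)),
      (Measure.sum κ {y | (Fin.snoc x y : Fin (m + 1) → X) ∈ B}
          - ∑ j : Fin m, B.indicator 1 (Fin.snoc x (x j) : Fin (m + 1) → X))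
        = ∑' k : {k // k ∉ Set.range e}, κ k {y | (Fin.snoc x y : Fin (m + 1) → X) ∈ B} := by
    filter_upwards [h1] with x hx
    have hsec : MeasurableSet {y | (Fin.snoc x y : Fin (m + 1) → X) ∈ B} :=
      (measurable_snoc.comp (measurable_const.prodMk measurable_id)) hB
    rw [Measure.sum_apply _ hsec,
      ← ENNReal.summable.tsum_add_tsum_compl (s := Set.range e) ENNReal.summable,
      tsum_range (f := fun k => κ k {y | (Fin.snoc x y : Fin (m + 1) → X) ∈ B}) e.injective,
      tsum_fintype]
    simp only [hx]
    refine ENNReal.add_sub_cancel_left ?_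
    refine (ENNReal.sum_lt_top.2 fun j _ => ?_).ne
    by_cases hb : (Fin.snoc x (x j) : Fin (m + 1) → X) ∈ B <;> simp [hb]
  have h3 : ∀ k : {k // k ∉ Set.range e}, AEMeasurable
      (fun x : Fin m → X => κ k {y | (Fin.snoc x y : Fin (m + 1) → X) ∈ B})
      (Measure.pi fun j => κ (e j)) :=
    fun k => (measurable_measure_prodMk_left (measurable_snoc hB)).aemeasurable
  rw [lintegral_congr_ae h2, lintegral_tsum h3]
  refine tsum_congr fun k => ?_
  rw [← pi_snoc_apply (fun j => κ (e j)) (κ k) hB]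
  congr 2
  ext1 i
  refine Fin.lastCases ?_ (fun j => ?_) i
  · simp
  · simp

/-- If `μ = ∑ i, κ i` with `0`-`1`-valued `κ i`, then `μ^(m)` is the sum of the products
`κ (e 1) ⊗ ⋯ ⊗ κ (e m)` over all injective `m`-tuples `e` of indices. -/
theorem factorialMeasure_sum {X : Type*} [MeasurableSpace X] {ι : Type} [Countable ι]
    (κ : ι → Measure X) (hκ : ∀ i, IsZeroOne (κ i)) (m : ℕ) :
    factorialMeasure (Measure.sum κ) m =
      Measure.sum (fun e : Fin m ↪ ι => Measure.pi fun j => κ (e j)) := by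
  have hfin : ∀ i, IsFiniteMeasure (κ i) := fun i => (hκ i).isFiniteMeasure
  induction m with
  | zero =>
    have : Unique (Fin 0 ↪ ι) :=
      ⟨⟨⟨Fin.elim0, fun a => a.elim0⟩⟩, fun e => by ext a; exact a.elim0⟩
    ext B hB
    rw [Measure.sum_apply _ hB, tsum_eq_single default
      (fun e he => absurd (Subsingleton.elim e default) he), Measure.pi_of_empty _ Fin.elim0]
    rfl
  | succ m ih =>
    have h : ∃ ν : Measure (Fin (m + 1) → X), ∀ B, MeasurableSet B →
        ν B = ∫⁻ x : Fin m → X, (Measure.sum κ {y | (Fin.snoc x y : Fin (m + 1) → X) ∈ B}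
          - ∑ j : Fin m, B.indicator 1 (Fin.snoc x (x j) : Fin (m + 1) → X))
          ∂(factorialMeasure (Measure.sum κ) m) :=
      ⟨_, fun B hB => by rw [ih]; exact lintegral_sum_eq κ hκ m hB⟩
    ext B hB
    rw [factorialMeasure, dif_pos h, h.choose_spec B hB, ih, lintegral_sum_eq κ hκ m hB]

/-- The defining recursion holds for all integer-valued `σ`-finite measures. -/
theorem factorialMeasure_succ_apply {X : Type*} [MeasurableSpace X] (μ : Measure X)
    [SigmaFinite μ] (hμ : IsIntegerValued μ) (m : ℕ) {B : Set (Fin (m + 1) → X)}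
    (hB : MeasurableSet B) :
    factorialMeasure μ (m + 1) B =
      ∫⁻ x : Fin m → X, (μ {y | (Fin.snoc x y : Fin (m + 1) → X) ∈ B}
          - ∑ j : Fin m, B.indicator 1 (Fin.snoc x (x j) : Fin (m + 1) → X))
          ∂(factorialMeasure μ m) := by
  obtain ⟨ι, hι, κ, hκ, rfl⟩ := exists_zeroOne μ hμ
  rw [factorialMeasure_sum κ hκ, factorialMeasure_sum κ hκ, lintegral_sum_eq κ hκ m hB]

/-- For a countable sum of Dirac measures, `μ^(m)` is the sum of the Dirac measures at all tuples of
points with pairwise distinct indices. -/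
theorem factorialMeasure_sum_dirac {X : Type*} [MeasurableSpace X] {ι : Type} [Countable ι]
    (x : ι → X) (m : ℕ) :
    factorialMeasure (Measure.sum fun i => Measure.dirac (x i)) m =
      Measure.sum (fun e : Fin m ↪ ι => Measure.dirac fun j => x (e j)) := by
  rw [factorialMeasure_sum _ fun i B hB => by
    by_cases h : x i ∈ B <;> simp [Measure.dirac_apply' _ hB, h]]
  congr 1
  ext1 e
  refine Measure.pi_eq fun s hs => ?_
  rw [Measure.dirac_apply' _ (MeasurableSet.univ_pi hs)]
  simp only [Measure.dirac_apply' _ (hs _)]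
  by_cases h : ∀ j, x (e j) ∈ s j
  · simp [Set.indicator, h]
  · have h' := h
    push Not at h'
    obtain ⟨j, hj⟩ := h'
    rw [Finset.prod_eq_zero (Finset.mem_univ j) (by simp [hj])]
    simp [Set.indicator, h]

/-- `η` is a Poisson process on `X` with intensity measure `Λ`: a random element of the space of
integer-valued `σ`-finite measures (with the `σ`-field generated by the evaluations at measurable
sets) such that `η(B)` is Poisson distributed with mean `Λ(B)` (almost surely infinite if
`Λ(B) = ∞`), and `η(B_1), …, η(B_k)` are independent for pairwise disjoint `B_1, …, B_k`. -/
structure IsPoissonProcess {Ω X : Type*} [MeasurableSpace Ω] [MeasurableSpace X]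
    (P : Measure Ω) (η : Ω → Measure X) (Λ : Measure X) : Prop where
  measurable : Measurable η
  integerValued : ∀ ω, IsIntegerValued (η ω)
  sigmaFinite : ∀ ω, SigmaFinite (η ω)
  poisson : ∀ B, MeasurableSet B → Λ B ≠ ∞ →
    P.map (fun ω => η ω B) = (poissonMeasure (Λ B).toNNReal).map (fun k : ℕ => (k : ℝ≥0∞))
  infinite : ∀ B, MeasurableSet B → Λ B = ∞ → ∀ᵐ ω ∂P, η ω B = ∞
  indep : ∀ (k : ℕ) (B : Fin k → Set X), (∀ i, MeasurableSet (B i)) →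
    Pairwise (fun i j => Disjoint (B i) (B j)) → iIndepFun (fun i ω => η ω (B i)) P

/-- The U-statistic `c * ∫ f dμ^(m)`. -/
noncomputable def uStatistic {X : Type*} [MeasurableSpace X] {m : ℕ} (c : ℝ)
    (f : (Fin m → X) → ℝ) (μ : Measure X) : ℝ :=
  c * ∫ x, f x ∂(factorialMeasure μ m)

/-- The kernel
`f_n(x_1, …, x_n) = (m choose n) ∫ f(x_1, …, x_n, y_1, …, y_{m-n}) Λ^{m-n}(d(y_1, …, y_{m-n}))`,
for `n ≤ m`. -/
noncomputable def chaosKernel {X : Type*} [MeasurableSpace X] {m : ℕ} (Λ : Measure X)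
    (f : (Fin m → X) → ℝ) (n : ℕ) (x : Fin n → X) : ℝ :=
  (m.choose n : ℝ) * ∫ y : Fin (m - n) → X,
    f (fun i => if h : (i : ℕ) < n then x ⟨i, h⟩ else y ⟨(i : ℕ) - n, by omega⟩)
    ∂(Measure.pi fun _ => Λ)

/-- `Π(n_1, …, n_ℓ)`: the partitions of the disjoint union of the rows `J_1, …, J_ℓ` of lengths
`n_1, …, n_ℓ` (the `k`-th entry of `J_i` is `⟨i, k⟩`) such that every block meets every row in at
most one element. A partition is encoded by its equivalence relation; its blocks are the elements
of the quotient. -/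
def nonFlatPartitions {ℓ : ℕ} (n : Fin ℓ → ℕ) : Set (Setoid (Σ i : Fin ℓ, Fin (n i))) :=
  {σ | ∀ (i : Fin ℓ) (k k' : Fin (n i)), σ ⟨i, k⟩ ⟨i, k'⟩ → k = k'}

/-- `(f_1 ⊗ ⋯ ⊗ f_ℓ)_σ`: the tensor product with the arguments in each block of `σ` identified, as a
function of one variable per block. -/
def tensorOn {X : Type*} {ℓ : ℕ} {n : Fin ℓ → ℕ} (f : (i : Fin ℓ) → (Fin (n i) → X) → ℝ)
    (σ : Setoid (Σ i : Fin ℓ, Fin (n i))) (x : Quotient σ → X) : ℝ :=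
  ∏ i, f i (fun k => x (Quotient.mk σ ⟨i, k⟩))

open Classical in
/-- `∫ (|f_1| ⊗ ⋯ ⊗ |f_ℓ|)_σ dΛ^{|σ|} < ∞`. -/
def FiniteTensorIntegral {X : Type*} [MeasurableSpace X] {ℓ : ℕ} {n : Fin ℓ → ℕ} (Λ : Measure X)
    (f : (i : Fin ℓ) → (Fin (n i) → X) → ℝ) (σ : Setoid (Σ i : Fin ℓ, Fin (n i))) : Prop :=
  ∫⁻ x : Quotient σ → X, ENNReal.ofReal (tensorOn (fun i y => |f i y|) σ x)
    ∂(Measure.pi fun _ => Λ) < ∞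

/-- `log E exp(𝐢 (z_1 Y_1 + ⋯ + z_ℓ Y_ℓ))`. -/
noncomputable def logCharFun {Ω : Type*} [MeasurableSpace Ω] (P : Measure Ω) {ℓ : ℕ}
    (Y : Fin ℓ → Ω → ℝ) (z : Fin ℓ → ℝ) : ℂ :=
  Complex.log (∫ ω, Complex.exp (Complex.I * ((∑ j, z j * Y j ω : ℝ) : ℂ)) ∂P)

/-- The joint cumulant `(-𝐢)^ℓ ∂^ℓ/∂z_1⋯∂z_ℓ log E exp(𝐢 (z_1 Y_1 + ⋯ + z_ℓ Y_ℓ))` at `z = 0`, by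
successive partial derivatives (`lineDeriv` along the standard basis vectors). -/
noncomputable def jointCumulant {Ω : Type*} [MeasurableSpace Ω] (P : Measure Ω) {ℓ : ℕ}
    (Y : Fin ℓ → Ω → ℝ) : ℂ :=
  (-Complex.I) ^ ℓ *
    (List.finRange ℓ).foldr
      (fun j (G : (Fin ℓ → ℝ) → ℂ) => fun z => lineDeriv ℝ G z (Pi.single j 1))
      (logCharFun P Y) 0

/-- The `ℓ`-th cumulant `γ_ℓ(Y) = γ(Y, …, Y)`. -/
noncomputable def cumulant {Ω : Type*} [MeasurableSpace Ω] (P : Measure Ω) (ℓ : ℕ)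
    (Y : Ω → ℝ) : ℂ :=
  jointCumulant P (fun _ : Fin ℓ => Y)

end PoissonU

/-!
The proof is the method of moments, organized around cumulants.

*Moments.* For an integer-valued measure that is a sum of `0`-`1`-valued measures (in the place of
Dirac measures), a product of `ℓ` sums over `m`-tuples of distinct points is a sum over `ℓ` rows of
`m` indices, the indices in a row being distinct; sorting these by the pattern of coincidences
between different rows gives a sum, over the non-flat partitions `σ`, of integrals with respect to
the factorial measures of order `|σ|` (`prod_lintegral_factorialMeasure`). The factorial measures
of a Poisson process have the powers of the intensity as means (`IsPoissonProcess.mecke`), so that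
the moment of order `n ≤ ℓ` of `∫ f dη_t^(m)` is `∑ σ, t^{|σ|} ∫ (f^{⊗n})_σ dλ^{|σ|}`
(`integral_pow_eq_momentSum`). The same formula for `|f|` shows that the integrability assumption
for `ℓ` rows implies the one for fewer rows (`lintegral_partition_ne_top`).

*Cumulants.* The weight of a partition is multiplicative over unions of connected components of
rows, whence the moments `M` and the sums `K` over connected partitions satisfy the
moment-cumulant recursion `M (n + 1) = ∑ j, (n choose j) K (j + 1) M (n - j)` (`momentSum_succ`),
and so do the central moments, with `K 1` replaced by `0` (`central_recursion`). A connected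
partition of `n` rows has at most `n m - n + 1` blocks
(`RowConnected.card_quotient_add_card_le`). Therefore `K n` is of order `t^{n m - n + 1}`, while
`K 2`, the variance, is equivalent to `‖f_1‖² t^{2 m - 1}`
(`exists_tendsto_cumulantSum_two`): the partitions of two rows with `2 m - 1` blocks have a single
block with two elements. Hence `K n / (K 2)^{n / 2}` tends to zero for `n ≥ 3`, and by the
recursion the normalized central moments tend to those of the normal distribution
(`tendsto_central_moments`).

*Cumulants as derivatives.* The cumulants in the theorem are derivatives at `0` of the logarithm of
the characteristic function `φ`. The Leibniz rule applied to `φ' = φ (log φ)'` yields the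
moment-cumulant recursion for them (`moment_eq_sum_cumulant`), and convergence of the moments of
orders up to `ℓ` gives that of the cumulants (`tendsto_cumulant`).
-/

namespace PoissonU

/-! ### Factorial moments and the multivariate Mecke formula -/

/-- The falling factorial `x (x - 1) ⋯ (x - k + 1)` in `ℝ≥0∞`, with truncated subtraction. -/
noncomputable def ennrealDescFactorial (x : ℝ≥0∞) (k : ℕ) : ℝ≥0∞ :=
  ∏ i ∈ Finset.range k, (x - i)

theorem ennrealDescFactorial_natCast (n k : ℕ) :
    ennrealDescFactorial n k = (n.descFactorial k : ℝ≥0∞) := by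
  rw [Nat.descFactorial_eq_prod_range, ennrealDescFactorial]
  push_cast
  rfl

theorem measurable_ennrealDescFactorial (k : ℕ) :
    Measurable fun x => ennrealDescFactorial x k := by
  unfold ennrealDescFactorial
  fun_prop

/-- The factorial moments of the Poisson distribution. -/
theorem lintegral_descFactorial_poissonMeasure (r : NNReal) (k : ℕ) :
    ∫⁻ n : ℕ, (n.descFactorial k : ℝ≥0∞) ∂(poissonMeasure r) = (r : ℝ≥0∞) ^ k := by
  have hterm : ∀ n : ℕ, ENNReal.ofReal (Real.exp (-r) * r ^ (n + k) / ((n + k).factorial : ℝ))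
      * ((n + k).descFactorial k : ℝ≥0∞)
      = ENNReal.ofReal (Real.exp (-r) * r ^ n / (n.factorial : ℝ)) * (r : ℝ≥0∞) ^ k := by
    intro n
    have h1 : ((n.factorial : ℝ)) * ((n + k).descFactorial k : ℝ) = ((n + k).factorial : ℝ) := by
      have := Nat.factorial_mul_descFactorial (n := n + k) (k := k) (by omega)
      simp only [Nat.add_sub_cancel] at this
      exact_mod_cast this
    have h2 : ((n + k).descFactorial k : ℝ≥0∞)
        = ENNReal.ofReal ((n + k).descFactorial k : ℝ) := by simp
    have h3 : (r : ℝ≥0∞) ^ k = ENNReal.ofReal ((r : ℝ) ^ k) := by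
      rw [ENNReal.ofReal_pow r.coe_nonneg, ENNReal.ofReal_coe_nnreal]
    rw [h2, h3, ← ENNReal.ofReal_mul (by positivity), ← ENNReal.ofReal_mul (by positivity)]
    congr 1
    have : (n.factorial : ℝ) ≠ 0 := by positivity
    have h4 : ((n + k).descFactorial k : ℝ) ≠ 0 := by
      have := Nat.descFactorial_pos.2 (show k ≤ n + k by omega)
      positivity
    rw [← h1]
    field_simp
    ring
  have h1 : ∑' n : ℕ, ENNReal.ofReal (Real.exp (-r) * r ^ n / (n.factorial : ℝ)) = 1 := by
    rw [← ENNReal.ofReal_tsum_of_nonneg (fun n => by positivity)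
      (hasSum_one_poissonMeasure r).summable, (hasSum_one_poissonMeasure r).tsum_eq]
    simp
  rw [poissonMeasure, lintegral_sum_measure]
  simp only [lintegral_smul_measure, lintegral_dirac, smul_eq_mul]
  -- the terms with `n < k` vanish
  rw [← Summable.sum_add_tsum_nat_add' (k := k) ENNReal.summable, Finset.sum_eq_zero, zero_add]
  · simp_rw [hterm]
    rw [ENNReal.tsum_mul_right, h1, one_mul]
  · intro n hn
    rw [Nat.descFactorial_of_lt (Finset.mem_range.1 hn)]
    simp

/-- On a product of sets taken from a pairwise disjoint family, the factorial measure is a product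
of falling factorials of the numbers of points. -/
theorem factorialMeasure_pi_of_disjoint {X : Type*} [MeasurableSpace X] (μ : Measure X)
    [SigmaFinite μ] (hμ : IsIntegerValued μ) {J : Type*} [Fintype J] [DecidableEq J]
    (C : J → Set X) (hC : ∀ j, MeasurableSet (C j))
    (hd : Pairwise fun i j => Disjoint (C i) (C j)) (n : ℕ) (a : Fin n → J) :
    factorialMeasure μ n (Set.univ.pi fun i => C (a i))
      = ∏ j, ennrealDescFactorial (μ (C j)) (Finset.univ.filter fun i => a i = j).card := by
  induction n with
  | zero =>
    simp [factorialMeasure, ennrealDescFactorial]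
  | succ n ih =>
    obtain ⟨a, j, rfl⟩ : ∃ (b : Fin n → J) (j : J), a = Fin.snoc b j :=
      ⟨Fin.init a, a (Fin.last n), (Fin.snoc_init_self a).symm⟩
    have hR : MeasurableSet (Set.univ.pi fun i => C (a i)) :=
      MeasurableSet.univ_pi fun i => hC _
    have hmem : ∀ (x : Fin n → X) (y : X), (Fin.snoc x y : Fin (n + 1) → X) ∈
        (Set.univ.pi fun i => C ((Fin.snoc a j : Fin (n + 1) → J) i))
        ↔ x ∈ (Set.univ.pi fun i => C (a i)) ∧ y ∈ C j := by
      intro x y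
      simp [Set.mem_pi, Fin.forall_fin_succ']
    have hint : ∀ x : Fin n → X,
        (μ {y | (Fin.snoc x y : Fin (n + 1) → X) ∈
            (Set.univ.pi fun i => C ((Fin.snoc a j : Fin (n + 1) → J) i))}
          - ∑ k : Fin n, (Set.univ.pi fun i => C ((Fin.snoc a j : Fin (n + 1) → J) i)).indicator
            (1 : (Fin (n + 1) → X) → ℝ≥0∞) (Fin.snoc x (x k) : Fin (n + 1) → X))
        = (Set.univ.pi fun i => C (a i)).indicator (fun _ => μ (C j) -
            ((Finset.univ.filter fun i => a i = j).card : ℝ≥0∞)) x := by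
      intro x
      classical
      simp only [hmem, Set.indicator_apply, Pi.one_apply]
      by_cases hx : x ∈ (Set.univ.pi fun i => C (a i))
      · simp only [hx, true_and, if_true, Set.ofPred_mem_eq]
        congr 1
        rw [Finset.sum_ite, Finset.sum_const_zero, add_zero, Finset.sum_const, nsmul_eq_mul,
          mul_one]
        congr 2
        ext k
        simp only [Finset.mem_filter, Finset.mem_univ, true_and]
        have hk : x k ∈ C (a k) := hx k (Set.mem_univ k)
        constructor
        · intro h
          by_contra hne
          exact Set.disjoint_left.1 (hd hne) hk h
        · rintro rfl
          exact hk
      · simp [hx]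
    rw [factorialMeasure_succ_apply μ hμ n (MeasurableSet.univ_pi fun i => hC _)]
    simp_rw [hint]
    rw [lintegral_indicator hR, setLIntegral_const, ih a, mul_comm,
      ← Finset.prod_erase_mul _ _ (Finset.mem_univ j),
      ← Finset.prod_erase_mul (a := j) Finset.univ (fun i => ennrealDescFactorial (μ (C i)) _)
        (Finset.mem_univ j), mul_assoc]
    have hcard : ∀ i : J, (Finset.univ.filter fun k : Fin (n + 1) =>
        (Fin.snoc a j : Fin (n + 1) → J) k = i).card
        = (Finset.univ.filter fun k => a k = i).card + if j = i then 1 else 0 := by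
      intro i
      simp only [Finset.card_filter, Fin.sum_univ_castSucc, Fin.snoc_castSucc, Fin.snoc_last]
    congr 1
    · refine Finset.prod_congr rfl fun i hi => ?_
      rw [hcard, if_neg (Finset.ne_of_mem_erase hi).symm, add_zero]
    · rw [hcard, if_pos rfl, ennrealDescFactorial, ennrealDescFactorial, Finset.prod_range_succ]

section Mecke

variable {Ω X : Type*} [MeasurableSpace Ω] [MeasurableSpace X] {P : Measure Ω}
  {Λ : Measure X} {η : Ω → Measure X}

theorem IsPoissonProcess.measurable_apply (h : IsPoissonProcess P η Λ) {B : Set X}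
    (hB : MeasurableSet B) : Measurable fun ω => η ω B :=
  (Measure.measurable_coe hB).comp h.measurable

theorem IsPoissonProcess.lintegral_descFactorial (h : IsPoissonProcess P η Λ) {B : Set X}
    (hB : MeasurableSet B) (hf : Λ B ≠ ∞) (k : ℕ) :
    ∫⁻ ω, ennrealDescFactorial (η ω B) k ∂P = Λ B ^ k := by
  rw [← lintegral_map (f := fun x => ennrealDescFactorial x k)
    (measurable_ennrealDescFactorial k) (h.measurable_apply hB), h.poisson B hB hf,
    lintegral_map (measurable_ennrealDescFactorial k) (by fun_prop)]
  simp_rw [ennrealDescFactorial_natCast]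
  rw [lintegral_descFactorial_poissonMeasure, ENNReal.coe_toNNReal hf]

theorem IsPoissonProcess.iIndepFun_of_disjoint (h : IsPoissonProcess P η Λ) {J : Type*} [Fintype J]
    (C : J → Set X) (hC : ∀ j, MeasurableSet (C j))
    (hd : Pairwise fun i j => Disjoint (C i) (C j)) :
    iIndepFun (fun j ω => η ω (C j)) P := by
  have h1 := h.indep (Fintype.card J) (fun i => C ((Fintype.equivFin J).symm i)) (fun i => hC _)
    (fun i j hij => hd (by simpa using hij))
  simpa using h1.precomp (Fintype.equivFin J).injective

variable [IsProbabilityMeasure P] [SigmaFinite Λ]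

/-- The Mecke formula for a box whose sides belong to a pairwise disjoint family, by independence
and the factorial moments of the Poisson distribution. -/
theorem IsPoissonProcess.factorial_disjoint (h : IsPoissonProcess P η Λ) {J : Type*}
    [Fintype J] [DecidableEq J] (C : J → Set X) (hC : ∀ j, MeasurableSet (C j))
    (hd : Pairwise fun i j => Disjoint (C i) (C j)) (n : ℕ) (a : Fin n → J)
    (hf : ∀ i, Λ (C (a i)) ≠ ∞) :
    Measurable (fun ω => factorialMeasure (η ω) n (Set.univ.pi fun i => C (a i))) ∧
    ∫⁻ ω, factorialMeasure (η ω) n (Set.univ.pi fun i => C (a i)) ∂P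
      = Measure.pi (fun _ => Λ) (Set.univ.pi fun i => C (a i)) := by
  have := h.sigmaFinite
  have heq : ∀ ω, factorialMeasure (η ω) n (Set.univ.pi fun i => C (a i)) =
      ∏ j, ennrealDescFactorial (η ω (C j)) (Finset.univ.filter fun i => a i = j).card :=
    fun ω => factorialMeasure_pi_of_disjoint (η ω) (h.integerValued ω) C hC hd n a
  have hm : ∀ j, Measurable fun ω =>
      ennrealDescFactorial (η ω (C j)) (Finset.univ.filter fun i => a i = j).card :=
    fun j => (measurable_ennrealDescFactorial _).comp (h.measurable_apply (hC j))
  simp_rw [heq]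
  refine ⟨Finset.measurable_prod _ fun j _ => hm j, ?_⟩
  have hind : iIndepFun (fun j ω => ennrealDescFactorial (η ω (C j))
      (Finset.univ.filter fun i => a i = j).card) P := (h.iIndepFun_of_disjoint C hC hd).comp
    (fun j x => ennrealDescFactorial x (Finset.univ.filter fun i => a i = j).card)
    (fun j => measurable_ennrealDescFactorial _)
  rw [lintegral_prod_eq_prod_lintegral_of_indepFun Finset.univ _ hind hm, Measure.pi_pi,
    ← Finset.prod_fiberwise_of_maps_to (t := Finset.univ) (g := a) (fun _ _ => Finset.mem_univ _)]
  refine Finset.prod_congr rfl fun j _ => ?_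
  have hc : ∏ i ∈ Finset.univ.filter (fun i => a i = j), Λ (C (a i))
      = Λ (C j) ^ (Finset.univ.filter fun i => a i = j).card := by
    rw [Finset.prod_congr rfl (g := fun _ => Λ (C j)) (fun i hi => by
      rw [(Finset.mem_filter.1 hi).2]), Finset.prod_const]
  rw [hc]
  by_cases hj : (Finset.univ.filter fun i => a i = j).card = 0
  · simp [hj, ennrealDescFactorial]
  · obtain ⟨i, hi⟩ := Finset.card_pos.1 (Nat.pos_of_ne_zero hj)
    exact h.lintegral_descFactorial (hC j) ((Finset.mem_filter.1 hi).2 ▸ hf i) _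

/-- The Mecke formula for a box with sides of finite intensity, which is a finite disjoint union of
boxes whose sides belong to a pairwise disjoint family. -/
theorem IsPoissonProcess.factorial_pi (h : IsPoissonProcess P η Λ) (n : ℕ)
    (A : Fin n → Set X) (hA : ∀ i, MeasurableSet (A i)) (hf : ∀ i, Λ (A i) ≠ ∞) :
    Measurable (fun ω => factorialMeasure (η ω) n (Set.univ.pi A)) ∧
    ∫⁻ ω, factorialMeasure (η ω) n (Set.univ.pi A) ∂P
      = Measure.pi (fun _ => Λ) (Set.univ.pi A) := by
  classical
  -- the atoms of the algebra of sets generated by the sides of the box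
  let C : (Fin n → Bool) → Set X := fun s => ⋂ i, if s i then A i else (A i)ᶜ
  have hCm : ∀ s, MeasurableSet (C s) := fun s => MeasurableSet.iInter fun i => by
    split_ifs
    exacts [hA i, (hA i).compl]
  have hmemC : ∀ s y, y ∈ C s ↔ ∀ i, (s i = true ↔ y ∈ A i) := by
    intro s y
    simp only [C, Set.mem_iInter]
    refine forall_congr' fun i => ?_
    cases s i <;> simp
  have hCd : Pairwise fun s s' => Disjoint (C s) (C s') := by
    intro s s' hne
    refine Set.disjoint_left.2 fun y hy hy' => hne ?_
    ext1 i
    rw [Bool.eq_iff_iff, (hmemC s y).1 hy i, (hmemC s' y).1 hy' i]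
  let I : Finset (Fin n → Fin n → Bool) := Finset.univ.filter fun a => ∀ i, a i i = true
  have hU : Set.univ.pi A = ⋃ a ∈ I, Set.univ.pi fun i => C (a i) := by
    ext x
    simp only [I, Set.mem_pi, Set.mem_univ, forall_const, Set.mem_iUnion, Finset.mem_filter,
      Finset.mem_univ, true_and, hmemC, exists_prop]
    constructor
    · intro hx
      exact ⟨fun i k => decide (x i ∈ A k), fun i => by simpa using hx i, fun i k => by simp⟩
    · rintro ⟨a, ha, hx⟩ i
      exact (hx i i).1 (ha i)
  have hdisj : (I : Set (Fin n → Fin n → Bool)).PairwiseDisjoint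
      fun a => Set.univ.pi fun i => C (a i) := by
    intro a _ b _ hne
    obtain ⟨i, hi⟩ := Function.ne_iff.1 hne
    exact Set.disjoint_univ_pi.2 ⟨i, hCd hi⟩
  have hms : ∀ a ∈ I, MeasurableSet (Set.univ.pi fun i => C (a i)) :=
    fun a _ => MeasurableSet.univ_pi fun i => hCm _
  have key : ∀ a ∈ I, _ := fun a ha => h.factorial_disjoint C hCm hCd n a (fun i => by
    refine ne_top_of_le_ne_top (hf i) (measure_mono fun y hy => ?_)
    exact ((hmemC _ _).1 hy i).1 ((Finset.mem_filter.1 ha).2 i))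
  rw [hU]
  simp_rw [measure_biUnion_finset hdisj hms]
  refine ⟨Finset.measurable_fun_sum _ fun a ha => (key a ha).1, ?_⟩
  rw [lintegral_finsetSum' _ fun a ha => (key a ha).1.aemeasurable]
  exact Finset.sum_congr rfl fun a ha => (key a ha).2

/-- The truncation to a set `S` of finite intensity makes all the measures involved finite, as the
Dynkin system argument requires. -/
theorem IsPoissonProcess.factorial_inter (h : IsPoissonProcess P η Λ) (n : ℕ)
    {S : Set X} (hS : MeasurableSet S) (hSf : Λ S ≠ ∞) (B : Set (Fin n → X))
    (hB : MeasurableSet B) :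
    AEMeasurable (fun ω => factorialMeasure (η ω) n (B ∩ Set.univ.pi fun _ => S)) P ∧
    ∫⁻ ω, factorialMeasure (η ω) n (B ∩ Set.univ.pi fun _ => S) ∂P
      = Measure.pi (fun _ => Λ) (B ∩ Set.univ.pi fun _ => S) := by
  set R : Set (Fin n → X) := Set.univ.pi fun _ => S with hRdef
  have hR : MeasurableSet R := MeasurableSet.univ_pi fun _ => hS
  obtain ⟨hRm, hRi⟩ := h.factorial_pi n (fun _ => S) (fun _ => hS) (fun _ => hSf)
  have hRtop : Measure.pi (fun _ => Λ) R ≠ ∞ := by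
    rw [hRdef, Measure.pi_pi]
    exact ENNReal.prod_ne_top fun _ _ => hSf
  have hRae : ∀ᵐ ω ∂P, factorialMeasure (η ω) n R < ∞ :=
    ae_lt_top hRm (by rw [hRi]; exact hRtop)
  refine MeasurableSpace.induction_on_inter (C := fun B _ =>
    AEMeasurable (fun ω => factorialMeasure (η ω) n (B ∩ R)) P ∧
      ∫⁻ ω, factorialMeasure (η ω) n (B ∩ R) ∂P = Measure.pi (fun _ => Λ) (B ∩ R))
    (generateFrom_pi (α := fun _ => X)).symm isPiSystem_pi ?_ (fun t ht => ?_)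
    (fun t htm ih => ?_) (fun t hd htm ih => ?_) B hB
  · simp
  · obtain ⟨A, hA, rfl⟩ := ht
    rw [hRdef, ← Set.pi_inter_distrib]
    have := h.factorial_pi n (fun i => A i ∩ S) (fun i => (hA i (Set.mem_univ i)).inter hS)
      (fun i => ne_top_of_le_ne_top hSf (measure_mono Set.inter_subset_right))
    exact ⟨this.1.aemeasurable, this.2⟩
  · have hc : tᶜ ∩ R = R \ (t ∩ R) := by ext; simp [and_comm]
    have heq : (fun ω => factorialMeasure (η ω) n (tᶜ ∩ R)) =ᵐ[P]
        fun ω => factorialMeasure (η ω) n R - factorialMeasure (η ω) n (t ∩ R) := by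
      filter_upwards [hRae] with ω hω
      rw [hc, measure_sdiff Set.inter_subset_right (htm.inter hR).nullMeasurableSet
        (ne_top_of_le_ne_top hω.ne (measure_mono Set.inter_subset_right))]
    refine ⟨(hRm.aemeasurable.sub ih.1).congr heq.symm, ?_⟩
    have hle : Measure.pi (fun _ => Λ) (t ∩ R) ≠ ∞ :=
      ne_top_of_le_ne_top hRtop (measure_mono Set.inter_subset_right)
    rw [lintegral_congr_ae heq, lintegral_sub' ih.1 (by rw [ih.2]; exact hle)
      (ae_of_all _ fun ω => measure_mono Set.inter_subset_right), ih.2, hRi, hc,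
      measure_sdiff Set.inter_subset_right (htm.inter hR).nullMeasurableSet hle]
  · have hU : ∀ μ : Measure (Fin n → X), μ ((⋃ i, t i) ∩ R) = ∑' i, μ (t i ∩ R) := by
      intro μ
      rw [Set.iUnion_inter, measure_iUnion (fun i j hij => (hd hij).mono Set.inter_subset_left
        Set.inter_subset_left) fun i => (htm i).inter hR]
    simp_rw [hU]
    refine ⟨AEMeasurable.tsum fun i => (ih i).1, ?_⟩
    rw [lintegral_tsum fun i => (ih i).1]
    exact tsum_congr fun i => (ih i).2

theorem IsPoissonProcess.factorial_set (h : IsPoissonProcess P η Λ) (n : ℕ) (B : Set (Fin n → X))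
    (hB : MeasurableSet B) :
    AEMeasurable (fun ω => factorialMeasure (η ω) n B) P ∧
    ∫⁻ ω, factorialMeasure (η ω) n B ∂P = Measure.pi (fun _ => Λ) B := by
  let R : ℕ → Set (Fin n → X) := fun k => Set.univ.pi fun _ => spanningSets Λ k
  have hmono : Monotone fun k => B ∩ R k := fun k l hkl =>
    Set.inter_subset_inter_right _ (Set.pi_mono fun _ _ => monotone_spanningSets Λ hkl)
  have hRU : ⋃ k, R k = Set.univ := by
    refine Set.eq_univ_of_forall fun x => Set.mem_iUnion.2 ?_
    refine ⟨Finset.univ.sup fun i => spanningSetsIndex Λ (x i), fun i _ => ?_⟩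
    exact monotone_spanningSets Λ (Finset.le_sup (f := fun i => spanningSetsIndex Λ (x i))
      (Finset.mem_univ i)) (mem_spanningSetsIndex Λ (x i))
  have hsup : ∀ μ : Measure (Fin n → X), μ B = ⨆ k, μ (B ∩ R k) := by
    intro μ
    rw [← hmono.measure_iUnion, ← Set.inter_iUnion, hRU, Set.inter_univ]
  have key : ∀ k, _ := fun k => h.factorial_inter n (measurableSet_spanningSets Λ k)
    (measure_spanningSets_lt_top Λ k).ne B hB
  have heq : (fun ω => factorialMeasure (η ω) n B)
      = fun ω => ⨆ k, factorialMeasure (η ω) n (B ∩ R k) := funext fun ω => hsup _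
  rw [heq]
  refine ⟨AEMeasurable.iSup fun k => (key k).1, ?_⟩
  rw [lintegral_iSup' (fun k => (key k).1)
    (ae_of_all _ fun ω k l hkl => measure_mono (hmono hkl)), hsup (Measure.pi fun _ => Λ)]
  exact iSup_congr fun k => (key k).2

/-- The multivariate Mecke formula for functions that do not depend on the process:
`E ∫ h dη^(n) = ∫ h dΛ^n`, for measurable `h ≥ 0`. -/
theorem IsPoissonProcess.mecke (h : IsPoissonProcess P η Λ) (n : ℕ) (φ : (Fin n → X) → ℝ≥0∞)
    (hφ : Measurable φ) :
    AEMeasurable (fun ω => ∫⁻ x, φ x ∂(factorialMeasure (η ω) n)) P ∧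
    ∫⁻ ω, ∫⁻ x, φ x ∂(factorialMeasure (η ω) n) ∂P = ∫⁻ x, φ x ∂(Measure.pi fun _ => Λ) := by
  refine Measurable.ennreal_induction (motive := fun φ =>
    AEMeasurable (fun ω => ∫⁻ x, φ x ∂(factorialMeasure (η ω) n)) P ∧
    ∫⁻ ω, ∫⁻ x, φ x ∂(factorialMeasure (η ω) n) ∂P = ∫⁻ x, φ x ∂(Measure.pi fun _ => Λ))
    (fun c s hs => ?_) (fun u v _ hu hv ihu ihv => ?_) (fun u hu hmono ih => ?_) hφ
  · obtain ⟨h1, h2⟩ := h.factorial_set n s hs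
    simp_rw [lintegral_indicator hs, setLIntegral_const]
    exact ⟨h1.const_mul c, by rw [lintegral_const_mul'' _ h1, h2]⟩
  · simp only [Pi.add_apply]
    simp_rw [lintegral_add_left hu]
    exact ⟨ihu.1.add ihv.1, by rw [lintegral_add_left' ihu.1, ihu.2, ihv.2]⟩
  · simp only
    simp_rw [lintegral_iSup hu hmono]
    refine ⟨AEMeasurable.iSup fun k => (ih k).1, ?_⟩
    rw [lintegral_iSup' (fun k => (ih k).1)
      (ae_of_all _ fun ω k l hkl => lintegral_mono (hmono hkl))]
    exact iSup_congr fun k => (ih k).2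

end Mecke

/-! ### Products of U-statistics -/

/-- A product of `0`-`1`-valued probability measures is `0`-`1`-valued; the sets of measure `0` or
`1` form a Dynkin system that contains the boxes. -/
theorem IsZeroOne.pi {X : Type*} [MeasurableSpace X] {W : Type*} [Fintype W] (κ : W → Measure X)
    [∀ w, IsProbabilityMeasure (κ w)] (hκ : ∀ w, IsZeroOne (κ w)) :
    IsZeroOne (Measure.pi κ) := by
  intro B hB
  refine MeasurableSpace.induction_on_inter (C := fun B _ =>
    Measure.pi κ B = 0 ∨ Measure.pi κ B = 1)
    (generateFrom_pi (α := fun _ : W => X)).symm isPiSystem_pi ?_ (fun t ht => ?_)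
    (fun t htm ih => ?_) (fun t hd htm ih => ?_) B hB
  · simp
  · obtain ⟨A, hA, rfl⟩ := ht
    rw [Measure.pi_pi]
    by_cases h : ∃ w, κ w (A w) = 0
    · obtain ⟨w, hw⟩ := h
      exact Or.inl (Finset.prod_eq_zero (Finset.mem_univ w) hw)
    · push Not at h
      exact Or.inr (Finset.prod_eq_one fun w _ =>
        (hκ w _ (hA w (Set.mem_univ w))).resolve_left (h w))
  · rw [prob_compl_eq_one_sub htm]
    rcases ih with h | h <;> simp [h]
  · by_cases h : ∃ i, Measure.pi κ (t i) = 1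
    · obtain ⟨i, hi⟩ := h
      exact Or.inr (le_antisymm prob_le_one (hi ▸ measure_mono (Set.subset_iUnion t i)))
    · push Not at h
      exact Or.inl (measure_iUnion_null fun i => (ih i).resolve_right (h i))

/-- Measurable functions are almost everywhere constant under a `0`-`1`-valued measure. -/
theorem IsZeroOne.ae_eq_lintegral {Y : Type*} [MeasurableSpace Y] {κ : Measure Y}
    [IsProbabilityMeasure κ] (hκ : IsZeroOne κ) {φ : Y → ℝ≥0∞} (hφ : Measurable φ) :
    ∀ᵐ y ∂κ, φ y = ∫⁻ z, φ z ∂κ := by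
  obtain ⟨c, hc⟩ := exists_eventuallyEq_const_of_forall_separating (l := ae κ) (f := φ)
    MeasurableSet fun U hU => by
      rcases hκ _ (hφ hU) with h | h
      · exact Or.inr (measure_eq_zero_iff_ae_notMem.1 h)
      · exact Or.inl ((prob_compl_eq_zero_iff (hφ hU)).2 h)
  have h1 : ∫⁻ z, φ z ∂κ = c := by
    rw [lintegral_congr_ae hc]
    simp [Function.const]
  rw [h1]
  exact hc

/-- In the decomposition of an integer-valued measure the zero measures may be dropped. -/
theorem exists_zeroOne_isProbabilityMeasure {X : Type*} [MeasurableSpace X] (μ : Measure X)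
    [SigmaFinite μ] (hμ : IsIntegerValued μ) :
    ∃ (J : Type) (_ : Countable J) (κ : J → Measure X),
      (∀ j, IsZeroOne (κ j)) ∧ (∀ j, IsProbabilityMeasure (κ j)) ∧ μ = Measure.sum κ := by
  obtain ⟨J, _, κ, hκ, rfl⟩ := exists_zeroOne μ hμ
  refine ⟨{j // κ j ≠ 0}, inferInstance, fun j => κ j, fun j => hκ _, fun j => ⟨?_⟩, ?_⟩
  · exact (hκ _ _ MeasurableSet.univ).resolve_left fun h => j.2 (Measure.measure_univ_eq_zero.1 h)
  · ext B hB
    rw [Measure.sum_apply _ hB, Measure.sum_apply _ hB]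
    refine (tsum_subtype_eq_of_support_subset (f := fun j => κ j B) (s := {j | κ j ≠ 0})
      fun j hj h0 => hj ?_).symm
    simp [h0]

theorem measurePreserving_pi_comp_injective {X W V : Type*} [MeasurableSpace X] [Fintype W]
    [Fintype V] (κ : W → Measure X) [∀ w, IsProbabilityMeasure (κ w)] {q : V → W}
    (hq : Function.Injective q) :
    MeasurePreserving (fun (x : W → X) v => x (q v)) (Measure.pi κ)
      (Measure.pi fun v => κ (q v)) where
  measurable := by fun_prop
  map_eq := by
    classical
    symm
    refine Measure.pi_eq fun s hs => ?_
    rw [Measure.map_apply (by fun_prop) (MeasurableSet.univ_pi hs)]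
    have hpre : (fun (x : W → X) v => x (q v)) ⁻¹' Set.univ.pi s
        = Set.univ.pi fun w => ⋂ (v : V) (_ : q v = w), s v := by
      ext x
      simp only [Set.mem_preimage, Set.mem_pi, Set.mem_univ, forall_const, Set.mem_iInter]
      exact ⟨fun h w v hv => hv ▸ h v, fun h v => h _ v rfl⟩
    rw [hpre, Measure.pi_pi, ← Finset.prod_subset (Finset.subset_univ (Finset.univ.image q)),
      Finset.prod_image fun a _ b _ h => hq h]
    · refine Finset.prod_congr rfl fun v _ => ?_
      congr 1
      ext y
      simp only [Set.mem_iInter]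
      exact ⟨fun h => h v rfl, fun h v' hv' => hq hv' ▸ h⟩
    · intro w _ hw
      have : (⋂ (v : V) (_ : q v = w), s v) = Set.univ := by
        refine Set.eq_univ_of_forall fun y => Set.mem_iInter₂.2 fun v hv => ?_
        exact absurd (Finset.mem_image.2 ⟨v, Finset.mem_univ _, hv⟩) hw
      rw [this, measure_univ]

/-- Functions of arbitrarily overlapping groups of coordinates are independent under a product of
`0`-`1`-valued probability measures, because they are almost everywhere constant. -/
theorem lintegral_prod_pi_zeroOne {X W ι : Type*} [MeasurableSpace X] [Fintype W] [Fintype ι]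
    {m : ℕ} (κ : W → Measure X) [∀ w, IsProbabilityMeasure (κ w)] (hκ : ∀ w, IsZeroOne (κ w))
    (φ : ι → (Fin m → X) → ℝ≥0∞) (hφ : ∀ i, Measurable (φ i)) (q : ι → Fin m → W)
    (hq : ∀ i, Function.Injective (q i)) :
    ∫⁻ x, ∏ i, φ i (fun k => x (q i k)) ∂(Measure.pi κ)
      = ∏ i, ∫⁻ y, φ i y ∂(Measure.pi fun k => κ (q i k)) := by
  have h1 : ∀ᵐ x ∂(Measure.pi κ), ∀ i, φ i (fun k => x (q i k))
      = ∫⁻ y, φ i y ∂(Measure.pi fun k => κ (q i k)) := by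
    refine ae_all_iff.2 fun i => ?_
    exact (measurePreserving_pi_comp_injective κ (hq i)).quasiMeasurePreserving.ae
      ((IsZeroOne.pi _ fun k => hκ (q i k)).ae_eq_lintegral (hφ i))
  have h2 : (fun x => ∏ i, φ i (fun k => x (q i k))) =ᵐ[Measure.pi κ]
      fun _ => ∏ i, ∫⁻ y, φ i y ∂(Measure.pi fun k => κ (q i k)) := by
    filter_upwards [h1] with x hx
    exact Finset.prod_congr rfl fun i _ => hx i
  rw [lintegral_congr_ae h2]
  simp

/-- The factorial measure `μ^(|W|)` with the coordinates indexed by a finite type `W`. -/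
noncomputable def factorialMeasureOn {X : Type*} [MeasurableSpace X] (μ : Measure X) (W : Type*)
    [Fintype W] : Measure (W → X) :=
  (factorialMeasure μ (Fintype.card W)).map fun x w => x (Fintype.equivFin W w)

theorem map_pi_comp_equiv {X W V : Type*} [MeasurableSpace X] [Fintype W] [Fintype V]
    (κ : W → Measure X) [∀ w, SigmaFinite (κ w)] (e : V ≃ W) :
    (Measure.pi κ).map (fun x v => x (e v)) = Measure.pi fun v => κ (e v) := by
  symm
  refine Measure.pi_eq fun s hs => ?_
  rw [Measure.map_apply (by fun_prop) (MeasurableSet.univ_pi hs)]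
  have hpre : (fun (x : W → X) v => x (e v)) ⁻¹' Set.univ.pi s
      = Set.univ.pi fun w => s (e.symm w) := by
    ext x
    simp only [Set.mem_preimage, Set.mem_pi, Set.mem_univ, forall_const]
    exact ⟨fun h w => by simpa using h (e.symm w), fun h v => by simpa using h (e v)⟩
  rw [hpre, Measure.pi_pi, ← e.prod_comp]
  simp

theorem factorialMeasureOn_sum {X : Type*} [MeasurableSpace X] {J : Type} [Countable J]
    (κ : J → Measure X) (hκ : ∀ j, IsZeroOne (κ j)) (W : Type*) [Fintype W] :
    factorialMeasureOn (Measure.sum κ) W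
      = Measure.sum fun e : W ↪ J => Measure.pi fun w => κ (e w) := by
  have hfin : ∀ j, IsFiniteMeasure (κ j) := fun j => (hκ j).isFiniteMeasure
  rw [factorialMeasureOn, factorialMeasure_sum κ hκ, Measure.map_sum
    (Measurable.aemeasurable (by fun_prop))]
  ext B hB
  rw [Measure.sum_apply _ hB, Measure.sum_apply _ hB,
    ← (Equiv.embeddingCongr (Fintype.equivFin W).symm (Equiv.refl J)).tsum_eq]
  refine tsum_congr fun e => ?_
  rw [map_pi_comp_equiv (fun k => κ (e k)) (Fintype.equivFin W)]
  rfl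

theorem prod_tsum_fin {E : Type*} (n : ℕ) (c : Fin n → E → ℝ≥0∞) :
    ∏ i, ∑' e, c i e = ∑' E : Fin n → E, ∏ i, c i (E i) := by
  induction n with
  | zero => simp
  | succ n ih =>
    rw [Fin.prod_univ_succ, ih, ← ENNReal.tsum_mul_right,
      ← (Fin.consEquiv fun _ => E).tsum_eq, ENNReal.tsum_prod']
    refine tsum_congr fun e => ?_
    rw [← ENNReal.tsum_mul_left]
    refine tsum_congr fun E' => ?_
    simp [Fin.prod_univ_succ, Fin.consEquiv]

instance finite_setoid {V : Type*} [Finite V] : Finite (Setoid V) :=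
  Finite.of_injective (fun σ : Setoid V => fun a b => σ a b) fun σ τ h =>
    Setoid.ext fun a b => by rw [show σ a b = τ a b from congrFun (congrFun h a) b]

/-- The partitions of `ι × {1, …, m}` each of whose blocks meets every row `{i} × {1, …, m}` in at
most one element, for an arbitrary finite type `ι` of rows; for `ι = Fin ℓ` these are the members
of `nonFlatPartitions`. -/
noncomputable def nonFlat (ι : Type*) [Finite ι] (m : ℕ) : Finset (Setoid (Σ _ : ι, Fin m)) :=
  (Set.toFinite {σ : Setoid (Σ _ : ι, Fin m) |
    ∀ (i : ι) (k k' : Fin m), σ ⟨i, k⟩ ⟨i, k'⟩ → k = k'}).toFinset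

theorem mem_nonFlat {ι : Type*} [Finite ι] {m : ℕ} {σ : Setoid (Σ _ : ι, Fin m)} :
    σ ∈ nonFlat ι m ↔ ∀ (i : ι) (k k' : Fin m), σ ⟨i, k⟩ ⟨i, k'⟩ → k = k' := by
  simp [nonFlat]

/-- A family of injections of `{1, …, m}`, one for each row, amounts to a non-flat partition (the
kernel of the joint map) together with an injection of its set of blocks. -/
theorem bijective_nonFlat_embedding (ι : Type*) [Finite ι] (m : ℕ) (J : Type*) :
    Function.Bijective (fun p : Σ σ : {σ // σ ∈ nonFlat ι m}, (Quotient σ.1 ↪ J) =>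
      fun i => (⟨fun k => p.2 (Quotient.mk p.1.1 ⟨i, k⟩), fun k k' h =>
        mem_nonFlat.1 p.1.2 i k k' (Quotient.exact (p.2.injective h))⟩ : Fin m ↪ J)) := by
  constructor
  · rintro ⟨⟨σ, hσ⟩, e⟩ ⟨⟨σ', hσ'⟩, e'⟩ h
    have h' : ∀ v, e (Quotient.mk σ v) = e' (Quotient.mk σ' v) := fun v =>
      DFunLike.congr_fun (congrFun h v.1) v.2
    have hs : σ = σ' := by
      ext v w
      rw [← Quotient.eq (r := σ), ← Quotient.eq (r := σ'), ← e.injective.eq_iff,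
        ← e'.injective.eq_iff, h', h']
    subst hs
    have he : e = e' := by
      ext a
      obtain ⟨v, rfl⟩ := Quotient.exists_rep a
      exact h' v
    rw [he]
  · intro E
    let u : (Σ _ : ι, Fin m) → J := fun v => E v.1 v.2
    refine ⟨⟨⟨Setoid.ker u, mem_nonFlat.2 fun i k k' h => (E i).injective h⟩,
      ⟨Setoid.kerLift u, Setoid.kerLift_injective u⟩⟩, ?_⟩
    ext i k
    rfl

open Classical in
/-- The product of U-statistics of nonnegative functions is a sum of U-statistics of the tensor
products with identified arguments, over the non-flat partitions. -/
theorem prod_lintegral_factorialMeasure {X : Type*} [MeasurableSpace X] (μ : Measure X)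
    [SigmaFinite μ] (hμ : IsIntegerValued μ) {ℓ m : ℕ} (φ : Fin ℓ → (Fin m → X) → ℝ≥0∞)
    (hφ : ∀ i, Measurable (φ i)) :
    ∏ i, ∫⁻ y, φ i y ∂(factorialMeasure μ m) = ∑ σ ∈ nonFlat (Fin ℓ) m,
      ∫⁻ x, ∏ i, φ i (fun k => x (Quotient.mk σ ⟨i, k⟩)) ∂(factorialMeasureOn μ (Quotient σ)) := by
  obtain ⟨J, _, κ, hκ, hp, rfl⟩ := exists_zeroOne_isProbabilityMeasure μ hμ
  have h1 : ∀ i, ∫⁻ y, φ i y ∂(factorialMeasure (Measure.sum κ) m)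
      = ∑' e : Fin m ↪ J, ∫⁻ y, φ i y ∂(Measure.pi fun k => κ (e k)) := fun i => by
    rw [factorialMeasure_sum κ hκ, lintegral_sum_measure]
  simp_rw [h1, factorialMeasureOn_sum κ hκ, lintegral_sum_measure]
  rw [prod_tsum_fin,
    ← (Equiv.ofBijective _ (bijective_nonFlat_embedding (Fin ℓ) m J)).tsum_eq,
    ENNReal.tsum_sigma', tsum_fintype, ← Finset.sum_coe_sort (nonFlat (Fin ℓ) m)]
  refine Finset.sum_congr rfl fun σ _ => tsum_congr fun e => ?_
  exact (lintegral_prod_pi_zeroOne (fun a => κ (e a)) (fun a => hκ _) φ hφ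
    (fun i k => Quotient.mk σ.1 ⟨i, k⟩)
    fun i k k' h => mem_nonFlat.1 σ.2 i k k' (Quotient.exact h)).symm

section Moments

variable {Ω X : Type*} [MeasurableSpace Ω] [MeasurableSpace X] {P : Measure Ω}
  [IsProbabilityMeasure P] {Λ : Measure X} [SigmaFinite Λ] {η : Ω → Measure X}

theorem IsPoissonProcess.mecke_on (h : IsPoissonProcess P η Λ) {W : Type*} [Fintype W]
    (φ : (W → X) → ℝ≥0∞) (hφ : Measurable φ) :
    AEMeasurable (fun ω => ∫⁻ x, φ x ∂(factorialMeasureOn (η ω) W)) P ∧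
    ∫⁻ ω, ∫⁻ x, φ x ∂(factorialMeasureOn (η ω) W) ∂P = ∫⁻ x, φ x ∂(Measure.pi fun _ => Λ) := by
  have h1 : ∀ μ : Measure X, ∫⁻ x, φ x ∂(factorialMeasureOn μ W)
      = ∫⁻ x, φ (fun w => x (Fintype.equivFin W w)) ∂(factorialMeasure μ (Fintype.card W)) :=
    fun μ => lintegral_map hφ (by fun_prop)
  simp_rw [h1]
  obtain ⟨h2, h3⟩ := h.mecke (Fintype.card W)
    (fun x => φ (fun w => x (Fintype.equivFin W w))) (by fun_prop)
  refine ⟨h2, h3.trans ?_⟩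
  rw [← map_pi_comp_equiv (fun _ => Λ) (Fintype.equivFin W), lintegral_map hφ (by fun_prop)]

open Classical in
/-- The mixed moments of U-statistics of nonnegative functions. -/
theorem IsPoissonProcess.lintegral_prod_uStatistic (h : IsPoissonProcess P η Λ) {ℓ m : ℕ}
    (φ : Fin ℓ → (Fin m → X) → ℝ≥0∞) (hφ : ∀ i, Measurable (φ i)) :
    ∫⁻ ω, ∏ i, ∫⁻ y, φ i y ∂(factorialMeasure (η ω) m) ∂P = ∑ σ ∈ nonFlat (Fin ℓ) m,
      ∫⁻ x, ∏ i, φ i (fun k => x (Quotient.mk σ ⟨i, k⟩)) ∂(Measure.pi fun _ : Quotient σ => Λ) := by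
  have hsf := h.sigmaFinite
  simp_rw [fun ω => prod_lintegral_factorialMeasure (η ω) (h.integerValued ω) φ hφ]
  have hm : ∀ σ : Setoid (Σ _ : Fin ℓ, Fin m),
      Measurable fun x : Quotient σ → X => ∏ i, φ i (fun k => x (Quotient.mk σ ⟨i, k⟩)) :=
    fun σ => Finset.measurable_prod _ fun i _ => (hφ i).comp (by fun_prop)
  rw [lintegral_finsetSum' _ fun σ _ => (h.mecke_on _ (hm σ)).1]
  exact Finset.sum_congr rfl fun σ _ => (h.mecke_on _ (hm σ)).2

end Moments

/-! ### Decomposing partitions along their connected components -/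

section Weights

variable {X : Type*} [MeasurableSpace X] {ι : Type*} {m : ℕ}

open Classical in
/-- The integral `∫ (f ⊗ ⋯ ⊗ f)_σ dλ^{|σ|}`. -/
noncomputable def partitionIntegral [Fintype ι] (lam : Measure X) (f : (Fin m → X) → ℝ)
    (σ : Setoid (Σ _ : ι, Fin m)) : ℝ :=
  ∫ x : Quotient σ → X, ∏ i, f (fun k => x (Quotient.mk σ ⟨i, k⟩)) ∂(Measure.pi fun _ => lam)

theorem measurable_prod_comp [Fintype ι] {W : Type*} {f : (Fin m → X) → ℝ} (hf : Measurable f)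
    (q : (Σ _ : ι, Fin m) → W) :
    Measurable fun x : W → X => ∏ i, f (fun k => x (q ⟨i, k⟩)) :=
  Finset.measurable_prod _ fun i _ => hf.comp (by fun_prop)

/-- The blocks of `σ` may be labelled by any finite type. -/
theorem partitionIntegral_eq_of_ker [Fintype ι] (lam : Measure X) [SigmaFinite lam]
    {f : (Fin m → X) → ℝ}
    (hf : Measurable f) (σ : Setoid (Σ _ : ι, Fin m)) {W : Type*} [Fintype W]
    (q : (Σ _ : ι, Fin m) → W) (hq : Function.Surjective q) (hker : Setoid.ker q = σ) :
    partitionIntegral lam f σ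
        = ∫ x : W → X, ∏ i, f (fun k => x (q ⟨i, k⟩)) ∂(Measure.pi fun _ => lam) ∧
      Nat.card (Quotient σ) = Fintype.card W := by
  classical
  subst hker
  let e : Quotient (Setoid.ker q) ≃ W := Setoid.quotientKerEquivOfSurjective q hq
  have he : ∀ v, e (Quotient.mk _ v) = q v := fun v => rfl
  refine ⟨?_, by rw [Nat.card_congr e, Nat.card_eq_fintype_card]⟩
  rw [partitionIntegral, ← map_pi_comp_equiv (fun _ : W => lam) e, integral_map
    (Measurable.aemeasurable (by fun_prop)) (measurable_prod_comp hf _).aestronglyMeasurable]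
  rfl

/-- The contribution `t^{|σ|} ∫ (f ⊗ ⋯ ⊗ f)_σ dλ^{|σ|}` of the partition `σ` to the moments of the
U-statistic with kernel `f` for the intensity measure `tλ`. -/
noncomputable def partitionWeight [Fintype ι] (lam : Measure X) (f : (Fin m → X) → ℝ) (t : ℝ)
    (σ : Setoid (Σ _ : ι, Fin m)) : ℝ :=
  t ^ Nat.card (Quotient σ) * partitionIntegral lam f σ

/-- The set `B` of rows is a union of connected components of the partition `σ`. -/
def RowClosed {ι : Type*} {m : ℕ} (σ : Setoid (Σ _ : ι, Fin m)) (B : Set ι) : Prop :=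
  ∀ v w, σ v w → v.1 ∈ B → w.1 ∈ B

/-- The blocks of `σ` connect all rows. -/
def RowConnected {ι : Type*} {m : ℕ} (σ : Setoid (Σ _ : ι, Fin m)) : Prop :=
  ∀ B : Set ι, B.Nonempty → RowClosed σ B → B = Set.univ

open Classical in
/-- The sum of the weights of all non-flat partitions; this is the moment of order `|ι|`. -/
noncomputable def momentSum (ι : Type*) [Fintype ι] (lam : Measure X) (f : (Fin m → X) → ℝ)
    (t : ℝ) : ℝ :=
  ∑ σ ∈ nonFlat ι m, partitionWeight lam f t σ

open Classical in
/-- The sum of the weights of the connected non-flat partitions; this is the cumulant of order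
`|ι|`. -/
noncomputable def cumulantSum (ι : Type*) [Fintype ι] (lam : Measure X) (f : (Fin m → X) → ℝ)
    (t : ℝ) : ℝ :=
  ∑ σ ∈ nonFlat ι m with RowConnected σ, partitionWeight lam f t σ

/-- Restriction of a partition to the rows satisfying `p`. -/
def restrictRows {ι : Type*} {m : ℕ} (p : ι → Prop) (σ : Setoid (Σ _ : ι, Fin m)) :
    Setoid (Σ _ : {i // p i}, Fin m) :=
  σ.comap fun v => ⟨v.1, v.2⟩

theorem restrictRows_apply {ι : Type*} {m : ℕ} (p : ι → Prop) (σ : Setoid (Σ _ : ι, Fin m))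
    (v w : Σ _ : {i // p i}, Fin m) :
    restrictRows p σ v w ↔ σ ⟨v.1, v.2⟩ ⟨w.1, w.2⟩ := Iff.rfl

open Classical in
/-- Given partitions of the rows in `p` and of the other rows, the map to the disjoint union of the
two sets of blocks. -/
noncomputable def joinMap {ι : Type*} {m : ℕ} {p : ι → Prop} (σ₁ : Setoid (Σ _ : {i // p i}, Fin m))
    (σ₂ : Setoid (Σ _ : {i // ¬ p i}, Fin m)) (v : Σ _ : ι, Fin m) :
    Quotient σ₁ ⊕ Quotient σ₂ :=
  if h : p v.1 then Sum.inl (Quotient.mk σ₁ ⟨⟨v.1, h⟩, v.2⟩)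
  else Sum.inr (Quotient.mk σ₂ ⟨⟨v.1, h⟩, v.2⟩)

/-- The union of partitions of two complementary sets of rows. -/
noncomputable def joinRows {ι : Type*} {m : ℕ} {p : ι → Prop}
    (σ₁ : Setoid (Σ _ : {i // p i}, Fin m))
    (σ₂ : Setoid (Σ _ : {i // ¬ p i}, Fin m)) : Setoid (Σ _ : ι, Fin m) :=
  Setoid.ker (joinMap σ₁ σ₂)

section Join

variable {p : ι → Prop} (σ₁ : Setoid (Σ _ : {i // p i}, Fin m))
  (σ₂ : Setoid (Σ _ : {i // ¬ p i}, Fin m))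

theorem joinMap_inl (v : Σ _ : {i // p i}, Fin m) :
    joinMap σ₁ σ₂ ⟨v.1, v.2⟩ = Sum.inl (Quotient.mk σ₁ v) := by
  simp [joinMap, v.1.2]

theorem joinMap_inr (v : Σ _ : {i // ¬ p i}, Fin m) :
    joinMap σ₁ σ₂ ⟨v.1, v.2⟩ = Sum.inr (Quotient.mk σ₂ v) := by
  simp [joinMap, v.1.2]

theorem joinMap_surjective : Function.Surjective (joinMap σ₁ σ₂) := by
  rintro (a | a)
  · obtain ⟨v, rfl⟩ := Quotient.exists_rep a
    exact ⟨_, joinMap_inl σ₁ σ₂ v⟩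
  · obtain ⟨v, rfl⟩ := Quotient.exists_rep a
    exact ⟨_, joinMap_inr σ₁ σ₂ v⟩

theorem rowClosed_joinRows : RowClosed (joinRows σ₁ σ₂) {i | p i} := by
  intro v w h hv
  have h' : joinMap σ₁ σ₂ v = joinMap σ₁ σ₂ w := h
  by_contra hw
  rw [show v = ⟨(⟨v.1, hv⟩ : {i // p i}), v.2⟩ from rfl,
    show w = ⟨(⟨w.1, hw⟩ : {i // ¬ p i}), w.2⟩ from rfl] at h'
  rw [joinMap_inl σ₁ σ₂ ⟨⟨v.1, hv⟩, v.2⟩, joinMap_inr σ₁ σ₂ ⟨⟨w.1, hw⟩, w.2⟩] at h'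
  exact Sum.inl_ne_inr h'

theorem restrictRows_joinRows : restrictRows p (joinRows σ₁ σ₂) = σ₁ := by
  ext v w
  change joinMap σ₁ σ₂ ⟨v.1, v.2⟩ = joinMap σ₁ σ₂ ⟨w.1, w.2⟩ ↔ _
  rw [joinMap_inl, joinMap_inl, Sum.inl_injective.eq_iff, Quotient.eq]

theorem restrictRows_not_joinRows : restrictRows (fun i => ¬ p i) (joinRows σ₁ σ₂) = σ₂ := by
  ext v w
  change joinMap σ₁ σ₂ ⟨v.1, v.2⟩ = joinMap σ₁ σ₂ ⟨w.1, w.2⟩ ↔ _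
  rw [joinMap_inr, joinMap_inr, Sum.inr_injective.eq_iff, Quotient.eq]

theorem joinRows_restrictRows (σ : Setoid (Σ _ : ι, Fin m)) (h : RowClosed σ {i | p i}) :
    joinRows (restrictRows p σ) (restrictRows (fun i => ¬ p i) σ) = σ := by
  ext v w
  change joinMap _ _ v = joinMap _ _ w ↔ _
  by_cases hv : p v.1 <;> by_cases hw : p w.1
  · simp [joinMap, hv, hw, Quotient.eq, restrictRows_apply]
  · simp only [joinMap, hv, hw, dif_pos, dif_neg, not_false_eq_true, reduceCtorEq, false_iff]
    exact fun hs => hw (h v w hs hv)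
  · simp only [joinMap, hv, hw, dif_pos, dif_neg, not_false_eq_true, reduceCtorEq, false_iff]
    exact fun hs => hv (h w v (σ.symm hs) hw)
  · simp [joinMap, hv, hw, Quotient.eq, restrictRows_apply]

theorem joinRows_mem_nonFlat [Finite ι] (h₁ : σ₁ ∈ nonFlat _ m) (h₂ : σ₂ ∈ nonFlat _ m) :
    joinRows σ₁ σ₂ ∈ nonFlat ι m := by
  refine mem_nonFlat.2 fun i k k' h => ?_
  by_cases hi : p i
  · refine mem_nonFlat.1 h₁ ⟨i, hi⟩ k k' ?_
    rw [← restrictRows_joinRows σ₁ σ₂]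
    exact h
  · refine mem_nonFlat.1 h₂ ⟨i, hi⟩ k k' ?_
    rw [← restrictRows_not_joinRows σ₁ σ₂]
    exact h

theorem restrictRows_mem_nonFlat [Finite ι] {σ : Setoid (Σ _ : ι, Fin m)} (h : σ ∈ nonFlat ι m)
    (p : ι → Prop) : restrictRows p σ ∈ nonFlat _ m :=
  mem_nonFlat.2 fun i k k' hk => mem_nonFlat.1 h i k k' hk

/-- Multiplicativity of the weights, by Fubini. No integrability is needed, as `integral_prod_mul`
holds for all functions. -/
theorem partitionWeight_joinRows [Fintype ι] [i₁ : Fintype {i // p i}]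
    [i₂ : Fintype {i // ¬ p i}] (lam : Measure X) [SigmaFinite lam] {f : (Fin m → X) → ℝ}
    (hf : Measurable f) (t : ℝ) :
    partitionWeight lam f t (joinRows σ₁ σ₂)
      = partitionWeight lam f t σ₁ * partitionWeight lam f t σ₂ := by
  classical
  obtain rfl : i₁ = Subtype.fintype p := Subsingleton.elim _ _
  obtain rfl : i₂ = Subtype.fintype (fun i => ¬ p i) := Subsingleton.elim _ _
  obtain ⟨h1, h2⟩ := partitionIntegral_eq_of_ker lam hf (joinRows σ₁ σ₂) (joinMap σ₁ σ₂)
    (joinMap_surjective σ₁ σ₂) rfl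
  have h3 : partitionIntegral lam f (joinRows σ₁ σ₂)
      = partitionIntegral lam f σ₁ * partitionIntegral lam f σ₂ := by
    rw [h1, partitionIntegral, partitionIntegral, ← integral_prod_mul,
      ← (measurePreserving_sumPiEquivProdPi
        (fun _ : Quotient σ₁ ⊕ Quotient σ₂ => lam)).integral_comp'
        (g := fun z : (Quotient σ₁ → X) × (Quotient σ₂ → X) => _)]
    refine integral_congr_ae (ae_of_all _ fun x => ?_)
    simp only
    rw [← Fintype.prod_subtype_mul_prod_subtype p]
    congr 1
    · refine Finset.prod_congr rfl fun i _ => ?_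
      congr 1
      ext k
      rw [joinMap_inl σ₁ σ₂ ⟨i, k⟩]
      rfl
    · refine Finset.prod_congr rfl fun i _ => ?_
      congr 1
      ext k
      rw [joinMap_inr σ₁ σ₂ ⟨i, k⟩]
      rfl
  rw [partitionWeight, h2, h3, Fintype.card_sum, ← Nat.card_eq_fintype_card,
    ← Nat.card_eq_fintype_card, pow_add, partitionWeight, partitionWeight]
  ring

end Join

/-- The connected component of a row. -/
theorem existsUnique_component {ι : Type*} [Fintype ι] {m : ℕ} (σ : Setoid (Σ _ : ι, Fin m))
    (i₀ : ι) : ∃! B : Finset ι, i₀ ∈ B ∧ RowClosed σ {i | i ∈ B} ∧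
      RowConnected (restrictRows (fun i => i ∈ B) σ) := by
  classical
  -- the intersection of all closed sets of rows that contain `i₀`
  let D : Finset ι := Finset.univ.filter fun i => ∀ C : Set ι, RowClosed σ C → i₀ ∈ C → i ∈ C
  have hD : ∀ i, i ∈ D ↔ ∀ C : Set ι, RowClosed σ C → i₀ ∈ C → i ∈ C := by simp [D]
  have hDc : RowClosed σ {i | i ∈ D} := fun v w h hv =>
    (hD _).2 fun C hC h0 => hC v w h ((hD _).1 hv C hC h0)
  have h0 : i₀ ∈ D := (hD _).2 fun C _ h => h
  refine ⟨D, ⟨h0, hDc, ?_⟩, ?_⟩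
  · intro C hC hcl
    have himg : RowClosed σ {i | ∃ h : i ∈ D, (⟨i, h⟩ : {i // i ∈ D}) ∈ C} := by
      rintro v w h ⟨hv, hvC⟩
      exact ⟨hDc v w h hv, hcl ⟨⟨v.1, hv⟩, v.2⟩ ⟨⟨w.1, hDc v w h hv⟩, w.2⟩ h hvC⟩
    have hdiff : RowClosed σ {i | ∃ h : i ∈ D, (⟨i, h⟩ : {i // i ∈ D}) ∉ C} := by
      rintro v w h ⟨hv, hvC⟩
      refine ⟨hDc v w h hv, fun hw => hvC ?_⟩
      exact hcl ⟨⟨w.1, hDc v w h hv⟩, w.2⟩ ⟨⟨v.1, hv⟩, v.2⟩ (σ.symm h) hw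
    by_cases hi : (⟨i₀, h0⟩ : {i // i ∈ D}) ∈ C
    · refine Set.eq_univ_of_forall fun i => ?_
      obtain ⟨_, h⟩ := (hD _).1 i.2 _ himg ⟨h0, hi⟩
      exact h
    · obtain ⟨j, hj⟩ := hC
      obtain ⟨_, h⟩ := (hD _).1 j.2 _ hdiff ⟨h0, hi⟩
      exact absurd hj h
  · rintro B ⟨hB0, hBc, hBconn⟩
    refine Finset.Subset.antisymm (fun i hi => ?_) fun i hi => (hD i).1 hi _ hBc hB0
    have := hBconn {i | (i : ι) ∈ D} ⟨⟨i₀, hB0⟩, h0⟩ fun v w h hv => hDc _ _ h hv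
    exact (this ▸ Set.mem_univ _ : (⟨i, hi⟩ : {i // i ∈ B}) ∈ {i : {i // i ∈ B} | (i : ι) ∈ D})

/-- Decomposition of the moments according to the component of the row `i₀`. -/
theorem momentSum_eq_sum_component [Fintype ι] [DecidableEq ι] (lam : Measure X) [SigmaFinite lam]
    {f : (Fin m → X) → ℝ}
    (hf : Measurable f) (t : ℝ) (i₀ : ι) :
    momentSum ι lam f t = ∑ B : Finset ι with i₀ ∈ B,
      cumulantSum {i // i ∈ B} lam f t * momentSum {i // ¬ i ∈ B} lam f t := by
  classical
  -- `R σ B` says that `B` is the component of `i₀` with respect to `σ`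
  let R : Setoid (Σ _ : ι, Fin m) → Finset ι → Prop := fun σ B =>
    i₀ ∈ B ∧ RowClosed σ {i | i ∈ B} ∧ RowConnected (restrictRows (fun i => i ∈ B) σ)
  have h1 : ∀ σ : Setoid (Σ _ : ι, Fin m), partitionWeight lam f t σ
      = ∑ B : Finset ι, if R σ B then partitionWeight lam f t σ else 0 := by
    intro σ
    obtain ⟨B, hB, huniq⟩ := existsUnique_component σ i₀
    rw [Finset.sum_eq_single B, if_pos hB]
    · exact fun C _ hne => if_neg fun hC => hne (huniq C hC)
    · exact fun h => absurd (Finset.mem_univ B) h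
  rw [momentSum, Finset.sum_congr rfl fun σ _ => h1 σ, Finset.sum_comm, Finset.sum_filter]
  refine Finset.sum_congr rfl fun B _ => ?_
  split_ifs with hB
  · rw [← Finset.sum_filter, cumulantSum, momentSum, Finset.sum_mul_sum, ← Finset.sum_product']
    refine Finset.sum_bij'
      (i := fun σ _ => (restrictRows (fun i => i ∈ B) σ, restrictRows (fun i => ¬ i ∈ B) σ))
      (j := fun σ _ => joinRows σ.1 σ.2) ?_ ?_ ?_ ?_ ?_
    · intro σ hσ
      obtain ⟨hσ1, hσ2⟩ := Finset.mem_filter.1 hσ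
      exact Finset.mem_product.2 ⟨Finset.mem_filter.2 ⟨restrictRows_mem_nonFlat hσ1 _, hσ2.2.2⟩,
        restrictRows_mem_nonFlat hσ1 _⟩
    · rintro ⟨σ₁, σ₂⟩ hσ
      obtain ⟨hσ1, hσ2⟩ := Finset.mem_product.1 hσ
      obtain ⟨hσ1, hσ3⟩ := Finset.mem_filter.1 hσ1
      refine Finset.mem_filter.2 ⟨joinRows_mem_nonFlat _ _ hσ1 hσ2, hB, rowClosed_joinRows _ _, ?_⟩
      rw [restrictRows_joinRows]
      exact hσ3
    · intro σ hσ
      exact joinRows_restrictRows σ (Finset.mem_filter.1 hσ).2.2.1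
    · rintro ⟨σ₁, σ₂⟩ hσ
      exact Prod.ext (restrictRows_joinRows σ₁ σ₂) (restrictRows_not_joinRows σ₁ σ₂)
    · intro σ hσ
      have := partitionWeight_joinRows (restrictRows (fun i => i ∈ B) σ)
        (restrictRows (fun i => ¬ i ∈ B) σ) lam hf t
      rwa [joinRows_restrictRows σ (Finset.mem_filter.1 hσ).2.2.1] at this
  · exact Finset.sum_eq_zero fun σ _ => if_neg fun h => hB h.1

section Reindex

variable {ι' : Type*}

/-- Renaming the rows. -/
def reindexRows {ι ι' : Type*} {m : ℕ} (e : ι ≃ ι') (σ : Setoid (Σ _ : ι', Fin m)) :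
    Setoid (Σ _ : ι, Fin m) :=
  σ.comap fun v => ⟨e v.1, v.2⟩

theorem reindexRows_symm (e : ι ≃ ι') (σ : Setoid (Σ _ : ι, Fin m)) :
    reindexRows e (reindexRows e.symm σ) = σ := by
  ext v w
  change σ ⟨e.symm (e v.1), v.2⟩ ⟨e.symm (e w.1), w.2⟩ ↔ _
  simp

theorem reindexRows_mem_nonFlat [Finite ι] [Finite ι'] (e : ι ≃ ι') {σ : Setoid (Σ _ : ι', Fin m)}
    (h : σ ∈ nonFlat ι' m) : reindexRows e σ ∈ nonFlat ι m :=
  mem_nonFlat.2 fun i k k' hk => mem_nonFlat.1 h (e i) k k' hk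

theorem RowConnected.reindexRows (e : ι ≃ ι') {σ : Setoid (Σ _ : ι', Fin m)}
    (h : RowConnected σ) : RowConnected (reindexRows e σ) := by
  intro B hB hcl
  have := h (e.symm ⁻¹' B) (hB.preimage e.symm.surjective) fun v w hvw hv => by
    refine hcl ⟨e.symm v.1, v.2⟩ ⟨e.symm w.1, w.2⟩ ?_ hv
    change σ ⟨e (e.symm v.1), v.2⟩ ⟨e (e.symm w.1), w.2⟩
    simpa using hvw
  refine Set.eq_univ_of_forall fun i => ?_
  have hi : e i ∈ e.symm ⁻¹' B := this ▸ Set.mem_univ _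
  simpa using hi

theorem partitionWeight_reindexRows [Fintype ι] [Fintype ι'] (lam : Measure X) [SigmaFinite lam]
    {f : (Fin m → X) → ℝ}
    (hf : Measurable f) (t : ℝ) (e : ι ≃ ι') (σ : Setoid (Σ _ : ι', Fin m)) :
    partitionWeight lam f t (reindexRows e σ) = partitionWeight lam f t σ := by
  classical
  have hsurj : Function.Surjective
      (fun v : Σ _ : ι, Fin m => Quotient.mk σ (⟨e v.1, v.2⟩ : Σ _ : ι', Fin m)) := by
    intro a
    obtain ⟨v, rfl⟩ := Quotient.exists_rep a
    exact ⟨⟨e.symm v.1, v.2⟩, by simp⟩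
  obtain ⟨h1, h2⟩ := partitionIntegral_eq_of_ker lam hf (reindexRows e σ) _ hsurj (by
    ext v w
    exact Quotient.eq (r := σ))
  rw [partitionWeight, partitionWeight, h1, h2, Nat.card_eq_fintype_card, partitionIntegral]
  congr 1
  refine integral_congr_ae (ae_of_all _ fun x => ?_)
  exact e.prod_comp fun i => f fun k => x (Quotient.mk σ ⟨i, k⟩)

theorem momentSum_congr [Fintype ι] [Fintype ι'] (lam : Measure X) [SigmaFinite lam]
    {f : (Fin m → X) → ℝ}
    (hf : Measurable f) (t : ℝ) (e : ι ≃ ι') : momentSum ι lam f t = momentSum ι' lam f t := by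
  refine Finset.sum_bij' (i := fun σ _ => reindexRows e.symm σ) (j := fun σ _ => reindexRows e σ)
    (fun σ h => reindexRows_mem_nonFlat _ h) (fun σ h => reindexRows_mem_nonFlat _ h)
    (fun σ _ => reindexRows_symm e σ) (fun σ _ => reindexRows_symm e.symm σ)
    fun σ _ => (partitionWeight_reindexRows lam hf t e.symm σ).symm

theorem cumulantSum_congr [Fintype ι] [Fintype ι'] (lam : Measure X) [SigmaFinite lam]
    {f : (Fin m → X) → ℝ}
    (hf : Measurable f) (t : ℝ) (e : ι ≃ ι') :
    cumulantSum ι lam f t = cumulantSum ι' lam f t := by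
  classical
  refine Finset.sum_bij' (i := fun σ _ => reindexRows e.symm σ) (j := fun σ _ => reindexRows e σ)
    (fun σ h => ?_) (fun σ h => ?_)
    (fun σ _ => reindexRows_symm e σ) (fun σ _ => reindexRows_symm e.symm σ)
    fun σ _ => (partitionWeight_reindexRows lam hf t e.symm σ).symm
  · obtain ⟨h1, h2⟩ := Finset.mem_filter.1 h
    exact Finset.mem_filter.2 ⟨reindexRows_mem_nonFlat _ h1, h2.reindexRows _⟩
  · obtain ⟨h1, h2⟩ := Finset.mem_filter.1 h
    exact Finset.mem_filter.2 ⟨reindexRows_mem_nonFlat _ h1, h2.reindexRows _⟩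

end Reindex

/-- The recursion between moments and cumulants. -/
theorem momentSum_succ (lam : Measure X) [SigmaFinite lam] {f : (Fin m → X) → ℝ}
    (hf : Measurable f) (t : ℝ) (n : ℕ) :
    momentSum (Fin (n + 1)) lam f t = ∑ j ∈ Finset.range (n + 1),
      (n.choose j : ℝ) * (cumulantSum (Fin (j + 1)) lam f t * momentSum (Fin (n - j)) lam f t) := by
  classical
  let G : ℕ → ℝ := fun j => cumulantSum (Fin j) lam f t * momentSum (Fin (n + 1 - j)) lam f t
  have h1 : momentSum (Fin (n + 1)) lam f t
      = ∑ B : Finset (Fin (n + 1)), if 0 ∈ B then G B.card else 0 := by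
    rw [momentSum_eq_sum_component lam hf t 0, Finset.sum_filter]
    refine Finset.sum_congr (by congr) fun B _ => ?_
    split_ifs with hB
    · congr 1
      · exact cumulantSum_congr lam hf t (Fintype.equivFinOfCardEq (by simp))
      · exact momentSum_congr lam hf t (Fintype.equivFinOfCardEq (by simp))
    · rfl
  have h2 : (Finset.univ : Finset (Fin (n + 1))) = insert 0 (Finset.univ.image Fin.succ) := by
    ext i
    refine Fin.cases ?_ (fun j => ?_) i <;> simp
  have h3 : (0 : Fin (n + 1)) ∉ Finset.univ.image Fin.succ := by simp
  rw [h1, ← Finset.powerset_univ, h2, Finset.sum_powerset_insert h3, Finset.sum_eq_zero, zero_add]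
  · have h4 : ∀ B ∈ (Finset.univ.image (Fin.succ : Fin n → Fin (n + 1))).powerset,
        (if 0 ∈ insert 0 B then G (insert 0 B).card else 0) = G (B.card + 1) := by
      intro B hB
      rw [if_pos (Finset.mem_insert_self _ _), Finset.card_insert_of_notMem fun h =>
        h3 (Finset.mem_powerset.1 hB h)]
    rw [Finset.sum_congr rfl h4, Finset.sum_powerset_apply_card fun j => G (j + 1),
      Finset.card_image_of_injective _ (Fin.succ_injective n), Finset.card_univ, Fintype.card_fin]
    refine Finset.sum_congr rfl fun j _ => ?_
    have h5 : n + 1 - (j + 1) = n - j := by omega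
    simp only [nsmul_eq_mul, G]
    rw [h5]
  · intro B hB
    exact if_neg fun h => h3 (Finset.mem_powerset.1 hB h)

end Weights

/-! ### Growth of the cumulants -/

section Growth

variable {X : Type*} [MeasurableSpace X] {m : ℕ}

theorem enorm_finset_prod {κ : Type*} (s : Finset κ) (u : κ → ℝ) :
    ‖∏ i ∈ s, u i‖ₑ = ∏ i ∈ s, ‖u i‖ₑ := by
  classical
  induction s using Finset.induction_on with
  | empty => simp
  | insert i s hi ih => rw [Finset.prod_insert hi, Finset.prod_insert hi, enorm_mul, ih]

/-- A connected partition has few blocks: adding the rows one at a time, every row after the first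
one shares a block with the preceding ones. -/
theorem RowConnected.card_quotient_add_card_le {ι : Type*} [Fintype ι] [Nonempty ι]
    {σ : Setoid (Σ _ : ι, Fin m)} (h : RowConnected σ) :
    Nat.card (Quotient σ) + Fintype.card ι ≤ Fintype.card ι * m + 1 := by
  classical
  let blocks : Finset ι → Finset (Quotient σ) := fun S =>
    (S.sigma fun _ => Finset.univ).image (Quotient.mk σ)
  have key : ∀ k, 1 ≤ k → k ≤ Fintype.card ι →
      ∃ S : Finset ι, S.card = k ∧ (blocks S).card + k ≤ k * m + 1 := by
    intro k hk
    induction k, hk using Nat.le_induction with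
    | base =>
      intro _
      obtain ⟨i⟩ := ‹Nonempty ι›
      refine ⟨{i}, by simp, ?_⟩
      have : (blocks {i}).card ≤ m := Finset.card_image_le.trans (by simp [Finset.card_sigma])
      omega
    | succ k hk ih =>
      intro hk'
      obtain ⟨S, hS, hb⟩ := ih (by omega)
      have hne : (S : Set ι) ≠ Set.univ := by
        intro hu
        have : S = Finset.univ := by exact_mod_cast hu
        rw [this, Finset.card_univ] at hS
        omega
      have hncl : ¬ RowClosed σ (S : Set ι) := fun hcl =>
        hne (h _ (Finset.coe_nonempty.2 (Finset.card_pos.1 (by omega))) hcl)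
      simp only [RowClosed, not_forall] at hncl
      obtain ⟨v, w, hvw, hv, hw⟩ := hncl
      have hw' : w.1 ∉ S := hw
      refine ⟨insert w.1 S, by rw [Finset.card_insert_of_notMem hw', hS], ?_⟩
      have hsub : blocks (insert w.1 S) ⊆ blocks S ∪
          (Finset.univ.erase w.2).image fun j => Quotient.mk σ ⟨w.1, j⟩ := by
        intro a ha
        obtain ⟨⟨i, j⟩, hu, rfl⟩ := Finset.mem_image.1 ha
        rcases Finset.mem_insert.1 (Finset.mem_sigma.1 hu).1 with hi | hi
        · simp only at hi
          subst hi
          by_cases hj : j = w.2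
          · subst hj
            refine Finset.mem_union_left _ (Finset.mem_image.2 ⟨v, by simpa using hv, ?_⟩)
            exact Quotient.sound hvw
          · exact Finset.mem_union_right _ (Finset.mem_image.2 ⟨j, by simp [hj], rfl⟩)
        · exact Finset.mem_union_left _ (Finset.mem_image.2 ⟨⟨i, j⟩, by simpa using hi, rfl⟩)
      have h1 := (Finset.card_le_card hsub).trans (Finset.card_union_le _ _)
      have h2 : ((Finset.univ.erase w.2).image fun j =>
          Quotient.mk σ (⟨w.1, j⟩ : Σ _ : ι, Fin m)).card ≤ m - 1 :=
        Finset.card_image_le.trans (by simp)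
      have h3 := w.2.pos
      have h4 : (k + 1) * m = k * m + m := by ring
      omega
  obtain ⟨S, hS, hb⟩ := key (Fintype.card ι) Fintype.card_pos le_rfl
  have hSu : S = Finset.univ := (Finset.card_eq_iff_eq_univ S).1 hS
  have hbu : blocks S = Finset.univ := by
    refine Finset.eq_univ_of_forall fun a => ?_
    obtain ⟨v, rfl⟩ := Quotient.exists_rep a
    exact Finset.mem_image.2 ⟨v, by simp [hSu], rfl⟩
  rw [hbu, Finset.card_univ, ← Nat.card_eq_fintype_card] at hb
  exact hb

theorem tendsto_pow_div_sqrt_pow {a b : ℕ} (h : 2 * a < b) :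
    Tendsto (fun t : ℝ => t ^ a / √t ^ b) atTop (𝓝 0) := by
  have h1 := (tendsto_pow_div_pow_atTop_zero (𝕜 := ℝ) h).comp Real.tendsto_sqrt_atTop
  refine h1.congr' ?_
  filter_upwards [eventually_ge_atTop 0] with t ht
  simp only [Function.comp_apply, pow_mul, Real.sq_sqrt ht]

/-- The exponent `n m - n + 1` of the bound on the number of blocks is smaller than
`n (m - 1/2)` for `n ≥ 3`; powers of `√t` avoid the half-integer. -/
theorem tendsto_cumulantSum_of_three_le (lam : Measure X) (f : (Fin m → X) → ℝ) {n : ℕ}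
    (hn : 3 ≤ n) :
    Tendsto (fun t : ℝ => cumulantSum (Fin n) lam f t / (√t ^ (2 * m - 1)) ^ n) atTop (𝓝 0) := by
  classical
  have : Nonempty (Fin n) := ⟨⟨0, by omega⟩⟩
  simp_rw [cumulantSum, Finset.sum_div]
  rw [← Finset.sum_const_zero (s := (nonFlat (Fin n) m).filter RowConnected)]
  refine tendsto_finsetSum _ fun σ hσ => ?_
  have hcard := (Finset.mem_filter.1 hσ).2.card_quotient_add_card_le
  rw [Fintype.card_fin] at hcard
  have hlt : 2 * Nat.card (Quotient σ) < (2 * m - 1) * n := by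
    rcases Nat.eq_zero_or_pos m with rfl | hm
    · omega
    · obtain ⟨m, rfl⟩ : ∃ m', m = m' + 1 := ⟨m - 1, by omega⟩
      have h1 : (2 * (m + 1) - 1) * n = 2 * (m * n) + n := by
        rw [show 2 * (m + 1) - 1 = 2 * m + 1 by omega]; ring
      have h2 : n * (m + 1) = m * n + n := by ring
      omega
  have := (tendsto_pow_div_sqrt_pow hlt).mul_const (partitionIntegral lam f σ)
  rw [zero_mul] at this
  refine this.congr fun t => ?_
  rw [partitionWeight, pow_mul]
  ring

/-- For two rows, the joint map to the blocks of the partition in which `(0, p)` and `(1, q)` form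
the only block with two elements. -/
def pairMap (p q : Fin (m + 1)) (v : Σ _ : Fin 2, Fin (m + 1)) : Fin 1 ⊕ (Fin m ⊕ Fin m) :=
  (![p.insertNth (Sum.inl 0) (fun k => Sum.inr (Sum.inl k)),
    q.insertNth (Sum.inl 0) (fun k => Sum.inr (Sum.inr k))] :
      Fin 2 → Fin (m + 1) → Fin 1 ⊕ (Fin m ⊕ Fin m)) v.1 v.2

theorem pairMap_zero (p q : Fin (m + 1)) (k : Fin (m + 1)) : pairMap p q ⟨0, k⟩
    = (p.insertNth (Sum.inl 0) (fun k => Sum.inr (Sum.inl k)) :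
      Fin (m + 1) → Fin 1 ⊕ (Fin m ⊕ Fin m)) k := rfl

theorem pairMap_one (p q : Fin (m + 1)) (k : Fin (m + 1)) : pairMap p q ⟨1, k⟩
    = (q.insertNth (Sum.inl 0) (fun k => Sum.inr (Sum.inr k)) :
      Fin (m + 1) → Fin 1 ⊕ (Fin m ⊕ Fin m)) k := rfl

theorem pairMap_surjective (p q : Fin (m + 1)) : Function.Surjective (pairMap p q) := by
  rintro (a | a | a)
  · exact ⟨⟨0, p⟩, by rw [pairMap_zero, Fin.insertNth_apply_same, Subsingleton.elim a 0]⟩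
  · exact ⟨⟨0, p.succAbove a⟩, by rw [pairMap_zero, Fin.insertNth_apply_succAbove]⟩
  · exact ⟨⟨1, q.succAbove a⟩, by rw [pairMap_one, Fin.insertNth_apply_succAbove]⟩

theorem pairMap_zero_injective (p q : Fin (m + 1)) {k k' : Fin (m + 1)}
    (h : pairMap p q ⟨0, k⟩ = pairMap p q ⟨0, k'⟩) : k = k' := by
  rw [pairMap_zero, pairMap_zero] at h
  rcases Fin.eq_self_or_eq_succAbove p k with hk | ⟨a, rfl⟩ <;>
    rcases Fin.eq_self_or_eq_succAbove p k' with hk' | ⟨b, rfl⟩ <;> simp_all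

theorem pairMap_one_injective (p q : Fin (m + 1)) {k k' : Fin (m + 1)}
    (h : pairMap p q ⟨1, k⟩ = pairMap p q ⟨1, k'⟩) : k = k' := by
  rw [pairMap_one, pairMap_one] at h
  rcases Fin.eq_self_or_eq_succAbove q k with hk | ⟨a, rfl⟩ <;>
    rcases Fin.eq_self_or_eq_succAbove q k' with hk' | ⟨b, rfl⟩ <;> simp_all

theorem pairMap_zero_eq_one_iff (p q : Fin (m + 1)) {k k' : Fin (m + 1)} :
    pairMap p q ⟨0, k⟩ = pairMap p q ⟨1, k'⟩ ↔ k = p ∧ k' = q := by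
  rw [pairMap_zero, pairMap_one]
  rcases Fin.eq_self_or_eq_succAbove p k with rfl | ⟨a, rfl⟩ <;>
    rcases Fin.eq_self_or_eq_succAbove q k' with rfl | ⟨b, rfl⟩ <;> simp

theorem card_quotient_ker_pairMap (p q : Fin (m + 1)) :
    Nat.card (Quotient (Setoid.ker (pairMap p q))) = 2 * m + 1 := by
  rw [Nat.card_congr (Setoid.quotientKerEquivOfSurjective _ (pairMap_surjective p q))]
  simp
  ring

theorem ker_pairMap_mem_nonFlat (p q : Fin (m + 1)) :
    Setoid.ker (pairMap p q) ∈ nonFlat (Fin 2) (m + 1) := by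
  refine mem_nonFlat.2 fun i k k' h => ?_
  fin_cases i
  · exact pairMap_zero_injective p q h
  · exact pairMap_one_injective p q h

theorem rowConnected_ker_pairMap (p q : Fin (m + 1)) :
    RowConnected (Setoid.ker (pairMap p q)) := by
  intro B hB hcl
  have h : Setoid.ker (pairMap p q) ⟨0, p⟩ ⟨1, q⟩ :=
    (pairMap_zero_eq_one_iff p q).2 ⟨rfl, rfl⟩
  have h01 : (0 : Fin 2) ∈ B ↔ (1 : Fin 2) ∈ B :=
    ⟨fun h0 => hcl _ _ h h0, fun h1 => hcl _ _ ((Setoid.ker _).symm h) h1⟩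
  obtain ⟨i, hi⟩ := hB
  refine Set.eq_univ_of_forall fun j => ?_
  fin_cases i <;> fin_cases j <;> simp_all

/-- In a connected partition of two rows some `(0, p)` and `(1, q)` lie in a common block, so that
the partition is coarser than the kernel of `pairMap p q`; the numbers of blocks agree. -/
theorem exists_eq_ker_pairMap {σ : Setoid (Σ _ : Fin 2, Fin (m + 1))} (hc : RowConnected σ)
    (hcard : Nat.card (Quotient σ) = 2 * m + 1) : ∃ p q, σ = Setoid.ker (pairMap p q) := by
  classical
  have hncl : ¬ RowClosed σ {(0 : Fin 2)} := fun hcl => by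
    have h1 := hc {0} ⟨0, rfl⟩ hcl
    have : (1 : Fin 2) ∈ ({0} : Set (Fin 2)) := h1 ▸ Set.mem_univ _
    simp at this
  simp only [RowClosed, not_forall] at hncl
  obtain ⟨⟨i, p⟩, ⟨j, q⟩, hvw, hi, hj⟩ := hncl
  have hi' : i = 0 := hi
  have hj' : j = 1 := by
    have : j ≠ 0 := hj
    omega
  subst hi' hj'
  refine ⟨p, q, ?_⟩
  have hle : ∀ v w, Setoid.ker (pairMap p q) v w → σ v w := by
    rintro ⟨i, k⟩ ⟨j, k'⟩ h
    have h' : pairMap p q ⟨i, k⟩ = pairMap p q ⟨j, k'⟩ := h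
    fin_cases i <;> fin_cases j
    · rw [pairMap_zero_injective p q h']
    · obtain ⟨rfl, rfl⟩ := (pairMap_zero_eq_one_iff p q).1 h'
      exact hvw
    · obtain ⟨rfl, rfl⟩ := (pairMap_zero_eq_one_iff p q).1 h'.symm
      exact σ.symm hvw
    · rw [pairMap_one_injective p q h']
  let u : Quotient (Setoid.ker (pairMap p q)) → Quotient σ := Quotient.map id hle
  have hu : Function.Surjective u := by
    intro a
    obtain ⟨v, rfl⟩ := Quotient.exists_rep a
    exact ⟨Quotient.mk _ v, rfl⟩
  have hbij : Function.Bijective u := by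
    refine (Fintype.bijective_iff_surjective_and_card u).2 ⟨hu, ?_⟩
    rw [← Nat.card_eq_fintype_card, ← Nat.card_eq_fintype_card, hcard, card_quotient_ker_pairMap]
  ext v w
  refine ⟨fun h => ?_, hle v w⟩
  exact Quotient.exact (hbij.1 (show u (Quotient.mk _ v) = u (Quotient.mk _ w) from
    Quotient.sound h))

theorem apply_insertNth_of_symm {X : Type*} {m : ℕ} {f : (Fin (m + 1) → X) → ℝ}
    (hf_symm : ∀ (e : Equiv.Perm (Fin (m + 1))) (x : Fin (m + 1) → X), f (x ∘ e) = f x)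
    (p : Fin (m + 1)) (a : X) (y : Fin m → X) :
    f (p.insertNth a y) = f (Fin.cons a y) := by
  rw [← Fin.insertNth_comp_cycleRange_symm p a y]
  exact (hf_symm _ _).symm

theorem chaosKernel_one_eq (lam : Measure X) (f : (Fin (m + 1) → X) → ℝ) (x : Fin 1 → X) :
    chaosKernel lam f 1 x
      = (m + 1 : ℝ) * ∫ y : Fin m → X, f (Fin.cons (x 0) y) ∂(Measure.pi fun _ => lam) := by
  rw [chaosKernel, Nat.choose_one_right]
  push_cast
  congr 1
  refine integral_congr_ae (ae_of_all _ fun y => ?_)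
  simp only
  congr 1
  ext i
  refine Fin.cases ?_ (fun j => ?_) i
  · simp
  · simp

theorem prod_apply_pairMap {X : Type*} {m : ℕ} {f : (Fin (m + 1) → X) → ℝ}
    (hf_symm : ∀ (e : Equiv.Perm (Fin (m + 1))) (x : Fin (m + 1) → X), f (x ∘ e) = f x)
    (p q : Fin (m + 1)) (x : Fin 1 ⊕ (Fin m ⊕ Fin m) → X) :
    ∏ i, f (fun k => x (pairMap p q ⟨i, k⟩))
      = f (Fin.cons (x (Sum.inl 0)) fun k => x (Sum.inr (Sum.inl k)))
        * f (Fin.cons (x (Sum.inl 0)) fun k => x (Sum.inr (Sum.inr k))) := by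
  rw [Fin.prod_univ_two, ← apply_insertNth_of_symm hf_symm p, ← apply_insertNth_of_symm hf_symm q]
  congr 2
  · ext k
    rw [pairMap_zero]
    rcases Fin.eq_self_or_eq_succAbove p k with rfl | ⟨a, rfl⟩ <;> simp
  · ext k
    rw [pairMap_one]
    rcases Fin.eq_self_or_eq_succAbove q k with rfl | ⟨a, rfl⟩ <;> simp

open Classical in
/-- All `(m + 1)²` partitions of two rows with a single block of two elements contribute the same
amount, since `f` is symmetric; together they give `‖f_1‖²`. -/
theorem sq_mul_partitionIntegral_ker_pairMap (lam : Measure X) [SigmaFinite lam]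
    {f : (Fin (m + 1) → X) → ℝ} (hf : Measurable f)
    (hf_symm : ∀ (e : Equiv.Perm (Fin (m + 1))) (x : Fin (m + 1) → X), f (x ∘ e) = f x)
    (hfin : ∀ σ ∈ nonFlat (Fin 2) (m + 1), ∫⁻ x : Quotient σ → X,
      ∏ i, ‖f fun k => x (Quotient.mk σ ⟨i, k⟩)‖ₑ ∂(Measure.pi fun _ => lam) ≠ ∞)
    (p q : Fin (m + 1)) :
    (m + 1 : ℝ) ^ 2 * partitionIntegral lam f (Setoid.ker (pairMap p q))
        = ∫ x, chaosKernel lam f 1 x ^ 2 ∂(Measure.pi fun _ => lam) ∧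
      Integrable (fun x => chaosKernel lam f 1 x ^ 2) (Measure.pi fun _ => lam) := by
  let H : (Fin 1 ⊕ (Fin m ⊕ Fin m) → X) → ℝ := fun x =>
    f (Fin.cons (x (Sum.inl 0)) fun k => x (Sum.inr (Sum.inl k)))
      * f (Fin.cons (x (Sum.inl 0)) fun k => x (Sum.inr (Sum.inr k)))
  have hHq : H = fun x => ∏ i, f (fun k => x (pairMap p q ⟨i, k⟩)) :=
    funext fun x => (prod_apply_pairMap hf_symm p q x).symm
  have hHm : Measurable H := hHq ▸ measurable_prod_comp hf _
  have hint : Integrable H (Measure.pi fun _ => lam) := by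
    refine ⟨hHm.aestronglyMeasurable, ?_⟩
    let e : Quotient (Setoid.ker (pairMap p q)) ≃ Fin 1 ⊕ (Fin m ⊕ Fin m) :=
      Setoid.quotientKerEquivOfSurjective _ (pairMap_surjective p q)
    have h1 := hfin _ (ker_pairMap_mem_nonFlat p q)
    simp_rw [← enorm_finset_prod] at h1
    rw [← map_pi_comp_equiv (fun _ => lam) e,
      lintegral_map (measurable_prod_comp hf _).enorm (by fun_prop)] at h1
    rw [hasFiniteIntegral_def, hHq]
    exact h1.lt_top
  have hmp := measurePreserving_sumPiEquivProdPi (fun _ : Fin 1 ⊕ (Fin m ⊕ Fin m) => lam)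
  let K : (Fin 1 → X) × ((Fin m ⊕ Fin m) → X) → ℝ := fun z =>
    f (Fin.cons (z.1 0) fun k => z.2 (Sum.inl k)) * f (Fin.cons (z.1 0) fun k => z.2 (Sum.inr k))
  have hK : H = fun x => K (MeasurableEquiv.sumPiEquivProdPi _ x) := rfl
  have hKint : Integrable K ((Measure.pi fun _ => lam).prod (Measure.pi fun _ => lam)) :=
    (hmp.integrable_comp_emb (MeasurableEquiv.measurableEmbedding _)).1 hint
  have hin : ∀ a : Fin 1 → X, ∫ z, K (a, z) ∂(Measure.pi fun _ => lam)
      = (∫ y : Fin m → X, f (Fin.cons (a 0) y) ∂(Measure.pi fun _ => lam)) ^ 2 := by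
    intro a
    have hmp2 := measurePreserving_sumPiEquivProdPi (fun _ : Fin m ⊕ Fin m => lam)
    rw [sq, ← integral_prod_mul, ← hmp2.integral_comp' (g := fun z => _)]
    rfl
  have hsq : ∀ x : Fin 1 → X, chaosKernel lam f 1 x ^ 2
      = (m + 1 : ℝ) ^ 2 * ∫ z, K (x, z) ∂(Measure.pi fun _ => lam) := by
    intro x
    rw [chaosKernel_one_eq, hin, mul_pow]
  simp_rw [hsq]
  refine ⟨?_, hKint.integral_prod_left.const_mul _⟩
  rw [integral_const_mul, ← integral_prod _ hKint,
    (partitionIntegral_eq_of_ker lam hf _ _ (pairMap_surjective p q) rfl).1, ← hmp.integral_comp',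
    ← hHq]
  rfl

open Classical in
/-- The variance divided by `t ^ (2 m - 1)` has a positive limit `V`, namely the square of the
`L²`-norm of `chaosKernel lam f 1`. -/
theorem exists_tendsto_cumulantSum_two (hm : 1 ≤ m) (lam : Measure X) [SigmaFinite lam]
    {f : (Fin m → X) → ℝ} (hf : Measurable f)
    (hf_symm : ∀ (e : Equiv.Perm (Fin m)) (x : Fin m → X), f (x ∘ e) = f x)
    (hfin : ∀ σ ∈ nonFlat (Fin 2) m, ∫⁻ x : Quotient σ → X,
      ∏ i, ‖f fun k => x (Quotient.mk σ ⟨i, k⟩)‖ₑ ∂(Measure.pi fun _ => lam) ≠ ∞)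
    (hf1 : 0 < eLpNorm (chaosKernel lam f 1) 2 (Measure.pi fun _ => lam)) :
    ∃ V : ℝ, 0 < V ∧ Tendsto (fun t : ℝ => cumulantSum (Fin 2) lam f t / (√t ^ (2 * m - 1)) ^ 2)
      atTop (𝓝 V) := by
  obtain ⟨m, rfl⟩ : ∃ m', m = m' + 1 := ⟨m - 1, by omega⟩
  set V : ℝ := ∫ x, chaosKernel lam f 1 x ^ 2 ∂(Measure.pi fun _ => lam) with hV
  have hpq : ∀ p q : Fin (m + 1), _ := sq_mul_partitionIntegral_ker_pairMap lam hf hf_symm hfin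
  have hVpos : 0 < V := by
    refine lt_of_le_of_ne (integral_nonneg fun x => sq_nonneg _) fun h0 => hf1.ne' ?_
    have h1 := (integral_eq_zero_iff_of_nonneg (fun x => sq_nonneg _) (hpq 0 0).2).1 h0.symm
    have h2 : chaosKernel lam f 1 =ᵐ[Measure.pi fun _ => lam] 0 := by
      filter_upwards [h1] with x hx
      simpa using hx
    rw [eLpNorm_congr_ae h2, eLpNorm_zero]
  refine ⟨V, hVpos, ?_⟩
  have hsum : ∑ σ ∈ nonFlat (Fin 2) (m + 1) with RowConnected σ,
      (if Nat.card (Quotient σ) = 2 * m + 1 then partitionIntegral lam f σ else 0) = V := by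
    rw [← Finset.sum_filter, Finset.filter_filter]
    have h1 : ∑ pq : Fin (m + 1) × Fin (m + 1),
        partitionIntegral lam f (Setoid.ker (pairMap pq.1 pq.2))
        = ∑ σ ∈ nonFlat (Fin 2) (m + 1) with
            RowConnected σ ∧ Nat.card (Quotient σ) = 2 * m + 1, partitionIntegral lam f σ := by
      refine Finset.sum_bij (fun pq _ => Setoid.ker (pairMap pq.1 pq.2)) (fun pq _ => ?_)
        (fun a _ b _ hab => ?_) (fun σ hσ => ?_) fun _ _ => rfl
      · exact Finset.mem_filter.2 ⟨ker_pairMap_mem_nonFlat _ _, rowConnected_ker_pairMap _ _,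
          card_quotient_ker_pairMap _ _⟩
      · have h : Setoid.ker (pairMap b.1 b.2) ⟨0, a.1⟩ ⟨1, a.2⟩ :=
          hab ▸ (pairMap_zero_eq_one_iff a.1 a.2).2 ⟨rfl, rfl⟩
        exact Prod.ext_iff.2 ((pairMap_zero_eq_one_iff b.1 b.2).1 h)
      · obtain ⟨-, h2, h3⟩ := Finset.mem_filter.1 hσ
        obtain ⟨p, q, rfl⟩ := exists_eq_ker_pairMap h2 h3
        exact ⟨(p, q), Finset.mem_univ _, rfl⟩
    rw [← h1]
    have h2 : ∀ pq : Fin (m + 1) × Fin (m + 1),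
        partitionIntegral lam f (Setoid.ker (pairMap pq.1 pq.2)) = V / (m + 1 : ℝ) ^ 2 := by
      intro pq
      rw [hV, ← (hpq pq.1 pq.2).1]
      field_simp
    simp_rw [h2]
    rw [Finset.sum_const, Finset.card_univ, Fintype.card_prod, Fintype.card_fin, nsmul_eq_mul]
    push_cast
    field_simp
  rw [← hsum]
  simp_rw [cumulantSum, Finset.sum_div]
  refine tendsto_finsetSum _ fun σ hσ => ?_
  have hcard := (Finset.mem_filter.1 hσ).2.card_quotient_add_card_le
  rw [Fintype.card_fin] at hcard
  split_ifs with h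
  · refine tendsto_const_nhds.congr' ?_
    filter_upwards [eventually_gt_atTop 0] with t ht
    rw [partitionWeight, h, ← pow_mul, mul_comm (2 * (m + 1) - 1) 2, pow_mul, Real.sq_sqrt ht.le,
      show 2 * (m + 1) - 1 = 2 * m + 1 by omega]
    field_simp
  · have hlt : 2 * Nat.card (Quotient σ) < (2 * (m + 1) - 1) * 2 := by omega
    have := (tendsto_pow_div_sqrt_pow hlt).mul_const (partitionIntegral lam f σ)
    rw [zero_mul] at this
    refine this.congr fun t => ?_
    rw [partitionWeight, pow_mul]
    ring

end Growth

/-! ### Central moments -/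

/-- The exponential generating function of a sequence. -/
noncomputable def expGenFun (a : ℕ → ℝ) : PowerSeries ℝ :=
  PowerSeries.mk fun n => a n / (n.factorial : ℝ)

theorem expGenFun_injective : Function.Injective expGenFun := by
  intro a b h
  ext n
  have := congrArg (PowerSeries.coeff n) h
  simp only [expGenFun, PowerSeries.coeff_mk] at this
  have hn : (n.factorial : ℝ) ≠ 0 := by positivity
  field_simp at this
  exact this

theorem expGenFun_mul (a b : ℕ → ℝ) : expGenFun a * expGenFun b
    = expGenFun fun n => ∑ k ∈ Finset.range (n + 1), (n.choose k : ℝ) * (a k * b (n - k)) := by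
  ext n
  simp only [PowerSeries.coeff_mul, expGenFun, PowerSeries.coeff_mk]
  rw [Finset.Nat.sum_antidiagonal_eq_sum_range_succ
    (fun i j => a i / (i.factorial : ℝ) * (b j / (j.factorial : ℝ))), Finset.sum_div]
  refine Finset.sum_congr rfl fun k hk => ?_
  rw [Nat.cast_choose ℝ (Nat.lt_succ_iff.1 (Finset.mem_range.1 hk))]
  field_simp

theorem derivative_expGenFun (a : ℕ → ℝ) :
    PowerSeries.derivative ℝ (expGenFun a) = expGenFun fun n => a (n + 1) := by
  ext n
  rw [PowerSeries.coeff_derivative]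
  simp only [expGenFun, PowerSeries.coeff_mk]
  rw [Nat.factorial_succ]
  push_cast
  field_simp

/-- Subtracting a constant from a random variable only affects its first cumulant: if the moments
`M` and the cumulants `K` satisfy the moment-cumulant recursion, then so do the central moments and
the cumulants of order at least `2`. -/
theorem central_recursion {M K C : ℕ → ℝ}
    (hM : ∀ n, M (n + 1) = ∑ j ∈ Finset.range (n + 1), (n.choose j : ℝ) * (K (j + 1) * M (n - j)))
    (hC : ∀ n, C n = ∑ k ∈ Finset.range (n + 1), (n.choose k : ℝ) * (M k * (-K 1) ^ (n - k)))
    (n : ℕ) :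
    C (n + 1) = ∑ j ∈ Finset.range n,
      (n.choose (j + 1) : ℝ) * (K (j + 2) * C (n - (j + 1))) := by
  have h1 : expGenFun C = expGenFun M * expGenFun fun n => (-K 1) ^ n := by
    rw [expGenFun_mul]
    exact congrArg expGenFun (funext hC)
  have h2 : (expGenFun fun n => M (n + 1)) = (expGenFun fun j => K (j + 1)) * expGenFun M := by
    rw [expGenFun_mul]
    exact congrArg expGenFun (funext hM)
  have h3 : (expGenFun fun n => (-K 1) ^ (n + 1))
      = PowerSeries.C (-K 1) * expGenFun fun n => (-K 1) ^ n := by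
    ext n
    rw [PowerSeries.coeff_C_mul]
    simp only [expGenFun, PowerSeries.coeff_mk]
    ring
  have h4 : (expGenFun fun j => K (j + 1)) + PowerSeries.C (-K 1)
      = expGenFun fun j => if j = 0 then 0 else K (j + 1) := by
    ext n
    rw [map_add, PowerSeries.coeff_C]
    simp only [expGenFun, PowerSeries.coeff_mk]
    split_ifs with h
    · subst h
      simp
    · simp
  have h5 : (expGenFun fun n => C (n + 1))
      = (expGenFun fun j => if j = 0 then 0 else K (j + 1)) * expGenFun C := by
    rw [← derivative_expGenFun, h1, Derivation.leibniz, derivative_expGenFun,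
      derivative_expGenFun, h2, h3, ← h4, smul_eq_mul, smul_eq_mul]
    ring
  rw [expGenFun_mul] at h5
  have h6 := congrFun (expGenFun_injective h5) n
  rw [h6, Finset.sum_range_succ']
  simp

/-- The moments of the standard normal distribution. -/
noncomputable def gaussianMoment (n : ℕ) : ℝ :=
  if Even n then (Nat.doubleFactorial (n - 1) : ℝ) else 0

theorem gaussianMoment_zero : gaussianMoment 0 = 1 := by simp [gaussianMoment]

theorem gaussianMoment_one : gaussianMoment 1 = 0 := by simp [gaussianMoment]

theorem gaussianMoment_add_two (n : ℕ) :
    gaussianMoment (n + 2) = (n + 1 : ℝ) * gaussianMoment n := by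
  have h : Even (n + 2) ↔ Even n := by simp [Nat.even_add]
  simp only [gaussianMoment, h]
  split_ifs
  · cases n with
    | zero => simp
    | succ n =>
      rw [show n + 1 + 2 - 1 = n + 2 by omega, Nat.add_sub_cancel, Nat.doubleFactorial_add_two]
      push_cast
      ring
  · simp

/-- If the normalized cumulants of order at least `3` tend to zero, then the normalized central
moments tend to those of the normal distribution. -/
theorem tendsto_central_moments {K C : ℝ → ℕ → ℝ} {s : ℝ → ℝ} {l : Filter ℝ}
    (hC0 : ∀ᶠ t in l, C t 0 = 1)
    (hC : ∀ᶠ t in l, ∀ n, C t (n + 1) = ∑ j ∈ Finset.range n,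
      (n.choose (j + 1) : ℝ) * (K t (j + 2) * C t (n - (j + 1))))
    (hK2 : Tendsto (fun t => K t 2 / s t ^ 2) l (𝓝 1))
    (hK : ∀ n, 3 ≤ n → Tendsto (fun t => K t n / s t ^ n) l (𝓝 0)) (n : ℕ) :
    Tendsto (fun t => C t n / s t ^ n) l (𝓝 (gaussianMoment n)) := by
  induction n using Nat.strong_induction_on with
  | _ n ih =>
  match n with
  | 0 =>
    rw [gaussianMoment_zero]
    refine tendsto_const_nhds.congr' ?_
    filter_upwards [hC0] with t ht
    simp [ht]
  | 1 =>
    rw [gaussianMoment_one]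
    refine tendsto_const_nhds.congr' ?_
    filter_upwards [hC] with t ht
    simp [ht 0]
  | n + 2 =>
    have h1 : Tendsto (fun t => ∑ j ∈ Finset.range (n + 1), ((n + 1).choose (j + 1) : ℝ) *
        ((K t (j + 2) / s t ^ (j + 2)) * (C t (n - j) / s t ^ (n - j)))) l
        (𝓝 (∑ j ∈ Finset.range (n + 1), ((n + 1).choose (j + 1) : ℝ) *
          ((if j = 0 then 1 else 0) * gaussianMoment (n - j)))) := by
      refine tendsto_finsetSum _ fun j _ => ((Tendsto.mul ?_ (ih (n - j) (by omega))).const_mul _)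
      split_ifs with hj
      · subst hj
        exact hK2
      · exact hK (j + 2) (by omega)
    have h2 : ∑ j ∈ Finset.range (n + 1), ((n + 1).choose (j + 1) : ℝ) *
          ((if j = 0 then 1 else 0) * gaussianMoment (n - j)) = gaussianMoment (n + 2) := by
      rw [Finset.sum_eq_single 0, gaussianMoment_add_two]
      · simp
      · intro j _ hj
        simp [hj]
      · simp
    rw [h2] at h1
    refine h1.congr' ?_
    filter_upwards [hC] with t ht
    rw [ht (n + 1), Finset.sum_div]
    refine Finset.sum_congr rfl fun j hj => ?_
    have hjn := Finset.mem_range.1 hj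
    rw [show n + 1 - (j + 1) = n - j by omega, show n + 2 = (j + 2) + (n - j) by omega,
      pow_add _ (j + 2), mul_div_assoc, mul_div_mul_comm]

/-! ### Cumulants as derivatives of the logarithm of the characteristic function -/

/-- Iterated partial derivatives of a function of the sum of the variables. Differentiability plays
no role, since `lineDeriv` and `deriv` are the same limit along the line. -/
theorem foldr_lineDeriv_comp_sum {ℓ : ℕ} (H : ℝ → ℂ) (L : List (Fin ℓ)) :
    L.foldr (fun j (G : (Fin ℓ → ℝ) → ℂ) => fun z => lineDeriv ℝ G z (Pi.single j 1))
      (fun z => H (∑ j, z j)) = fun z => iteratedDeriv L.length H (∑ j, z j) := by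
  induction L with
  | nil => simp
  | cons j L ih =>
    rw [List.foldr_cons, ih]
    ext z
    rw [lineDeriv]
    have h : ∀ t : ℝ, ∑ i, (z + t • (Pi.single j 1 : Fin ℓ → ℝ)) i = (∑ i, z i) + t := by
      intro t
      simp [Finset.sum_add_distrib, ← Finset.mul_sum]
    simp_rw [h]
    rw [deriv_comp_const_add (f := iteratedDeriv L.length H), List.length_cons,
      iteratedDeriv_succ, add_zero]

section Cumulant

variable {Ω : Type*} [MeasurableSpace Ω] {P : Measure Ω} {Y : Ω → ℝ}

theorem cumulant_eq_iteratedDeriv (hY : AEMeasurable Y P) (ℓ : ℕ) :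
    cumulant P ℓ Y = (-Complex.I) ^ ℓ *
      iteratedDeriv ℓ (fun z => Complex.log (charFun (P.map Y) z)) 0 := by
  have h : logCharFun P (fun _ : Fin ℓ => Y)
      = fun z => (fun z => Complex.log (charFun (P.map Y) z)) (∑ j, z j) := by
    ext z
    simp only
    rw [logCharFun, charFun_apply_real, integral_map hY (by fun_prop)]
    congr 2
    ext ω
    rw [← Finset.sum_mul]
    push_cast
    ring_nf
  rw [cumulant, jointCumulant, h,
    foldr_lineDeriv_comp_sum fun z => Complex.log (charFun (P.map Y) z)]
  simp

theorem iteratedDeriv_charFun_map_zero [IsProbabilityMeasure P] {n : ℕ} (hY : MemLp Y n P) :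
    iteratedDeriv n (charFun (P.map Y)) 0 = Complex.I ^ n * ((∫ ω, Y ω ^ n ∂P : ℝ) : ℂ) := by
  have := Measure.isProbabilityMeasure_map hY.aemeasurable
  have h1 : MemLp id n (P.map Y) :=
    (memLp_map_measure_iff aestronglyMeasurable_id hY.aemeasurable).2 hY
  rw [iteratedDeriv_charFun h1]
  simp only [Complex.ofReal_zero, zero_mul, Complex.exp_zero, mul_one]
  congr 1
  rw [integral_map hY.aemeasurable (by fun_prop), ← integral_complex_ofReal]
  simp

/-- The recursion between the moments and the cumulants of a random variable. -/
theorem moment_eq_sum_cumulant [IsProbabilityMeasure P] {n : ℕ} (hY : MemLp Y (n + 1 : ℕ) P) :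
    ((∫ ω, Y ω ^ (n + 1) ∂P : ℝ) : ℂ) = ∑ k ∈ Finset.range (n + 1), (n.choose k : ℂ) *
      (((∫ ω, Y ω ^ k ∂P : ℝ) : ℂ) * cumulant P (n + 1 - k) Y) := by
  have hYm := hY.aemeasurable
  have := Measure.isProbabilityMeasure_map hYm
  set φ : ℝ → ℂ := charFun (P.map Y) with hφ
  set h : ℝ → ℂ := fun z => Complex.log (φ z) with hh
  have hid : MemLp id (n + 1 : ℕ) (P.map Y) :=
    (memLp_map_measure_iff aestronglyMeasurable_id hYm).2 hY
  have hφc : ContDiff ℝ (n + 1 : ℕ) φ := contDiff_charFun hid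
  have hφ0 : φ 0 = 1 := by simp [hφ]
  have hslit : ∀ᶠ z in 𝓝 (0 : ℝ), φ z ∈ Complex.slitPlane :=
    hφc.continuous.continuousAt.eventually_mem (Complex.isOpen_slitPlane.mem_nhds (by
      rw [hφ0]; exact Complex.one_mem_slitPlane))
  have hhc : ContDiffAt ℝ (n + 1 : ℕ) h 0 :=
    ((Complex.contDiffAt_log hslit.self_of_nhds).restrict_scalars ℝ).comp 0 hφc.contDiffAt
  have hd : deriv φ =ᶠ[𝓝 0] φ * deriv h := by
    filter_upwards [hslit] with z hz
    have hφd : HasDerivAt φ (deriv φ z) z :=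
      ((hφc.differentiable (by simp)) z).hasDerivAt
    have hne := Complex.slitPlane_ne_zero hz
    rw [Pi.mul_apply, (hφd.clog_real hz).deriv]
    field_simp
  -- the Leibniz rule for `deriv φ = φ * deriv h` near `0`
  have hdh : ContDiffAt ℝ n (deriv h) 0 := hhc.derivWithin (by norm_cast)
  have hcum : ∀ k, iteratedDeriv k h 0 = Complex.I ^ k * cumulant P k Y := by
    intro k
    rw [cumulant_eq_iteratedDeriv hYm, ← mul_assoc, ← mul_pow]
    simp [hh, hφ]
  have hmom : ∀ k ≤ n + 1, iteratedDeriv k φ 0 = Complex.I ^ k * ((∫ ω, Y ω ^ k ∂P : ℝ) : ℂ) :=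
    fun k hk => iteratedDeriv_charFun_map_zero (hY.mono_exponent (by exact_mod_cast hk))
  have h1 : iteratedDeriv (n + 1) φ 0 = ∑ k ∈ Finset.range (n + 1), (n.choose k : ℂ) *
      iteratedDeriv k φ 0 * iteratedDeriv (n + 1 - k) h 0 := by
    rw [iteratedDeriv_succ', hd.iteratedDeriv_eq n,
      iteratedDeriv_mul (hφc.contDiffAt.of_le (by exact_mod_cast Nat.le_succ n)) hdh]
    refine Finset.sum_congr rfl fun k hk => ?_
    rw [Nat.succ_sub (Nat.lt_succ_iff.1 (Finset.mem_range.1 hk)), iteratedDeriv_succ']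
  rw [hmom (n + 1) le_rfl] at h1
  have hI : Complex.I ^ (n + 1) ≠ 0 := pow_ne_zero _ Complex.I_ne_zero
  refine mul_left_cancel₀ hI (h1.trans ?_)
  rw [Finset.mul_sum]
  refine Finset.sum_congr rfl fun k hk => ?_
  have hk' := Finset.mem_range.1 hk
  rw [hmom k (by omega), hcum]
  have : Complex.I ^ (n + 1) = Complex.I ^ k * Complex.I ^ (n + 1 - k) := by
    rw [← pow_add]; congr 1; omega
  rw [this]
  ring

/-- Convergence of the moments of orders at most `ℓ` to those of the standard normal distribution
entails convergence of the cumulants. -/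
theorem tendsto_cumulant {Y : ℝ → Ω → ℝ} [IsProbabilityMeasure P] {l : Filter ℝ} {ℓ : ℕ}
    (hY : ∀ᶠ t in l, MemLp (Y t) ℓ P)
    (hmom : ∀ n ≤ ℓ, Tendsto (fun t => ∫ ω, Y t ω ^ n ∂P) l (𝓝 (gaussianMoment n)))
    (n : ℕ) (hn1 : 1 ≤ n) (hn : n ≤ ℓ) :
    Tendsto (fun t => cumulant P n (Y t)) l (𝓝 (if n = 2 then 1 else 0)) := by
  have hmom' : ∀ n ≤ ℓ, Tendsto (fun t => ((∫ ω, Y t ω ^ n ∂P : ℝ) : ℂ)) l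
      (𝓝 (gaussianMoment n : ℂ)) := fun n hn =>
    (Complex.continuous_ofReal.tendsto _).comp (hmom n hn)
  induction n using Nat.strong_induction_on with
  | _ n ih =>
  obtain ⟨n, rfl⟩ : ∃ k, n = k + 1 := ⟨n - 1, by omega⟩
  have h1 : Tendsto (fun t => ((∫ ω, Y t ω ^ (n + 1) ∂P : ℝ) : ℂ) - ∑ k ∈ Finset.range n,
      (n.choose (k + 1) : ℂ) * (((∫ ω, Y t ω ^ (k + 1) ∂P : ℝ) : ℂ)
        * cumulant P (n - k) (Y t))) l
      (𝓝 ((gaussianMoment (n + 1) : ℂ) - ∑ k ∈ Finset.range n, (n.choose (k + 1) : ℂ) *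
        ((gaussianMoment (k + 1) : ℂ) * if n - k = 2 then 1 else 0))) := by
    refine (hmom' _ hn).sub (tendsto_finsetSum _ fun k hk => ?_)
    have hk' := Finset.mem_range.1 hk
    exact ((hmom' (k + 1) (by omega)).mul
      (ih (n - k) (by omega) (by omega) (by omega))).const_mul _
  have h2 : (gaussianMoment (n + 1) : ℂ) - ∑ k ∈ Finset.range n, (n.choose (k + 1) : ℂ) *
        ((gaussianMoment (k + 1) : ℂ) * if n - k = 2 then 1 else 0)
      = if n + 1 = 2 then 1 else 0 := by
    match n with
    | 0 => simp [gaussianMoment_one]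
    | 1 => simp [gaussianMoment_zero, gaussianMoment_add_two 0]
    | n + 2 =>
      rw [Finset.sum_eq_single n]
      · rw [show n + 2 + 1 = (n + 1) + 2 by omega, gaussianMoment_add_two]
        have : (n + 2).choose (n + 1) = n + 2 := Nat.choose_succ_self_right (n + 1)
        rw [this, if_pos (by omega), if_neg (by omega)]
        push_cast
        ring
      · intro k hk hne
        have hk' := Finset.mem_range.1 hk
        rw [if_neg (by omega), mul_zero, mul_zero]
      · simp
  rw [h2] at h1
  refine h1.congr' ?_
  filter_upwards [hY] with t ht
  rw [moment_eq_sum_cumulant (ht.mono_exponent (by exact_mod_cast hn)), Finset.sum_range_succ']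
  simp

end Cumulant

/-! ### Moments of the U-statistic -/

section MomentFormula

variable {Ω X : Type*} [MeasurableSpace Ω] [MeasurableSpace X]

/-- Expansion of the integral of a product of differences of nonnegative functions. It transfers the
moment formula from nonnegative functions to `f`, through `f = f⁺ - f⁻`. -/
theorem integral_prod_sub_toReal {Y : Type*} [MeasurableSpace Y] (ν : Measure Y) {n : ℕ}
    (G : Bool → Fin n → Y → ℝ≥0∞) (hG : ∀ b i, AEMeasurable (G b i) ν)
    (hfin : ∀ s : Fin n → Bool, ∫⁻ y, ∏ i, G (s i) i y ∂ν ≠ ∞) :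
    ∫ y, ∏ i, ((G true i y).toReal - (G false i y).toReal) ∂ν
      = ∑ s : Fin n → Bool, (∏ i, if s i then (1 : ℝ) else -1)
        * (∫⁻ y, ∏ i, G (s i) i y ∂ν).toReal := by
  have h1 : ∀ y, ∏ i, ((G true i y).toReal - (G false i y).toReal)
      = ∑ s : Fin n → Bool, (∏ i, if s i then (1 : ℝ) else -1) * (∏ i, G (s i) i y).toReal := by
    intro y
    simp_rw [ENNReal.toReal_prod, ← Finset.prod_mul_distrib]
    rw [← Fintype.prod_sum fun i (b : Bool) => (if b then (1 : ℝ) else -1) * (G b i y).toReal]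
    refine Finset.prod_congr rfl fun i _ => ?_
    simp [sub_eq_add_neg]
  have hm : ∀ s : Fin n → Bool, AEMeasurable (fun y => ∏ i, G (s i) i y) ν := fun s =>
    Finset.aemeasurable_fun_prod _ fun i _ => hG _ _
  simp_rw [h1]
  rw [integral_finsetSum _ fun s _ =>
    (integrable_toReal_of_lintegral_ne_top (hm s) (hfin s)).const_mul _]
  refine Finset.sum_congr rfl fun s _ => ?_
  rw [integral_const_mul, integral_toReal (hm s) (ae_lt_top' (hm s) (hfin s))]

theorem sigmaFinite_ofReal_smul (lam : Measure X) [SigmaFinite lam] (t : ℝ) :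
    SigmaFinite (ENNReal.ofReal t • lam) :=
  inferInstanceAs (SigmaFinite (t.toNNReal • lam))

theorem pi_ofReal_smul (lam : Measure X) [SigmaFinite lam] (t : ℝ) (W : Type*) [Fintype W] :
    Measure.pi (fun _ : W => ENNReal.ofReal t • lam)
      = ENNReal.ofReal t ^ Fintype.card W • Measure.pi fun _ => lam := by
  have := sigmaFinite_ofReal_smul lam t
  refine Measure.pi_eq fun s _ => ?_
  simp only [Measure.smul_apply, smul_eq_mul, Measure.pi_pi, Finset.prod_mul_distrib]
  simp

/-- The positive part of `f` (for `true`) or its negative part (for `false`). -/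
noncomputable def signPart {X : Type*} (f : X → ℝ) (b : Bool) (x : X) : ℝ≥0∞ :=
  if b then ENNReal.ofReal (f x) else ENNReal.ofReal (-f x)

theorem measurable_signPart {f : X → ℝ} (hf : Measurable f) (b : Bool) :
    Measurable (signPart f b) := by
  cases b
  · exact hf.neg.ennreal_ofReal
  · exact hf.ennreal_ofReal

theorem signPart_le_enorm {X : Type*} (f : X → ℝ) (b : Bool) (x : X) : signPart f b x ≤ ‖f x‖ₑ := by
  rw [Real.enorm_eq_ofReal_abs]
  cases b
  · exact ENNReal.ofReal_le_ofReal (neg_le_abs _)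
  · exact ENNReal.ofReal_le_ofReal (le_abs_self _)

theorem toReal_signPart_sub {X : Type*} (f : X → ℝ) (x : X) :
    (signPart f true x).toReal - (signPart f false x).toReal = f x := by
  simp only [signPart, if_true, Bool.false_eq_true, if_false, ENNReal.toReal_ofReal']
  exact max_zero_sub_max_neg_zero_eq_self _

open Classical in
theorem partitionIntegral_eq_sum_signs (lam : Measure X) [SigmaFinite lam] {m n : ℕ}
    {f : (Fin m → X) → ℝ} (hf : Measurable f) (σ : Setoid (Σ _ : Fin n, Fin m))
    (hfin : ∫⁻ x : Quotient σ → X,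
      ∏ i, ‖f fun k => x (Quotient.mk σ ⟨i, k⟩)‖ₑ ∂(Measure.pi fun _ => lam) ≠ ∞) :
    partitionIntegral lam f σ = ∑ s : Fin n → Bool, (∏ i, if s i then (1 : ℝ) else -1)
      * (∫⁻ x : Quotient σ → X, ∏ i, signPart f (s i) (fun k => x (Quotient.mk σ ⟨i, k⟩))
        ∂(Measure.pi fun _ => lam)).toReal := by
  rw [← integral_prod_sub_toReal _
    (fun b i (x : Quotient σ → X) => signPart f b (fun k => x (Quotient.mk σ ⟨i, k⟩)))
    (fun b i => ((measurable_signPart hf b).comp (by fun_prop)).aemeasurable)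
    (fun s => ne_top_of_le_ne_top hfin (lintegral_mono fun x =>
      Finset.prod_le_prod' fun i _ => signPart_le_enorm _ _ _))]
  simp_rw [toReal_signPart_sub]
  rfl

variable {P : Measure Ω} [IsProbabilityMeasure P] {lam : Measure X} [SigmaFinite lam]
  {η : Ω → Measure X} {t : ℝ} {m : ℕ} {f : (Fin m → X) → ℝ}

open Classical in
theorem lintegral_enorm_pow_eq (hη : IsPoissonProcess P η (ENNReal.ofReal t • lam))
    (hf : Measurable f) (n : ℕ) :
    ∫⁻ ω, (∫⁻ y, ‖f y‖ₑ ∂(factorialMeasure (η ω) m)) ^ n ∂P = ∑ σ ∈ nonFlat (Fin n) m,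
      ENNReal.ofReal t ^ Nat.card (Quotient σ) * ∫⁻ x : Quotient σ → X,
        ∏ i, ‖f fun k => x (Quotient.mk σ ⟨i, k⟩)‖ₑ ∂(Measure.pi fun _ => lam) := by
  have := sigmaFinite_ofReal_smul lam t
  have h := hη.lintegral_prod_uStatistic (fun _ : Fin n => fun y => ‖f y‖ₑ) fun _ => hf.enorm
  simp only [Finset.prod_const, Finset.card_univ, Fintype.card_fin] at h
  rw [h]
  refine Finset.sum_congr rfl fun σ _ => ?_
  rw [pi_ofReal_smul, lintegral_smul_measure, smul_eq_mul, Nat.card_eq_fintype_card]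

theorem aemeasurable_lintegral_enorm (hη : IsPoissonProcess P η (ENNReal.ofReal t • lam))
    (hf : Measurable f) :
    AEMeasurable (fun ω => ∫⁻ y, ‖f y‖ₑ ∂(factorialMeasure (η ω) m)) P := by
  have := sigmaFinite_ofReal_smul lam t
  exact (hη.mecke m _ hf.enorm).1

theorem lintegral_enorm_pow_ne_top {n ℓ : ℕ} (hn : n ≤ ℓ)
    (hA : ∫⁻ ω, (∫⁻ y, ‖f y‖ₑ ∂(factorialMeasure (η ω) m)) ^ ℓ ∂P ≠ ∞) :
    ∫⁻ ω, (∫⁻ y, ‖f y‖ₑ ∂(factorialMeasure (η ω) m)) ^ n ∂P ≠ ∞ := by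
  have hle : ∀ a : ℝ≥0∞, a ^ n ≤ 1 + a ^ ℓ := by
    intro a
    rcases le_total a 1 with h | h
    · exact (pow_le_one' h n).trans le_self_add
    · exact (pow_le_pow_right' h hn).trans le_add_self
  refine ne_top_of_le_ne_top ?_ (lintegral_mono fun ω => hle _)
  rw [lintegral_add_left measurable_const]
  simpa using hA

open Classical in
/-- The absolute tensor integrals over partitions of fewer than `ℓ` rows are finite as well, because
they are summands of lower moments of the U-statistic. -/
theorem lintegral_partition_ne_top {n ℓ : ℕ} (ht : 0 < t)
    (hη : IsPoissonProcess P η (ENNReal.ofReal t • lam)) (hf : Measurable f) (hn : n ≤ ℓ)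
    (hA : ∫⁻ ω, (∫⁻ y, ‖f y‖ₑ ∂(factorialMeasure (η ω) m)) ^ ℓ ∂P ≠ ∞) :
    ∀ σ ∈ nonFlat (Fin n) m, ∫⁻ x : Quotient σ → X,
        ∏ i, ‖f fun k => x (Quotient.mk σ ⟨i, k⟩)‖ₑ ∂(Measure.pi fun _ => lam) ≠ ∞ := by
  intro σ hσ htop
  refine lintegral_enorm_pow_ne_top hn hA ?_
  rw [lintegral_enorm_pow_eq hη hf, ENNReal.sum_eq_top]
  refine ⟨σ, hσ, ?_⟩
  rw [htop, ENNReal.mul_top]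
  simp [ht]

open Classical in
theorem lintegral_enorm_pow_ne_top_of_finiteTensorIntegral {ℓ : ℕ}
    (hη : IsPoissonProcess P η (ENNReal.ofReal t • lam)) (hf : Measurable f)
    (hint : ∀ σ ∈ nonFlatPartitions (fun _ : Fin ℓ => m),
      FiniteTensorIntegral lam (fun _ : Fin ℓ => f) σ) :
    ∫⁻ ω, (∫⁻ y, ‖f y‖ₑ ∂(factorialMeasure (η ω) m)) ^ ℓ ∂P ≠ ∞ := by
  rw [lintegral_enorm_pow_eq hη hf]
  refine ENNReal.sum_ne_top.2 fun σ hσ => ENNReal.mul_ne_top (by finiteness) ?_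
  have h := hint σ (mem_nonFlat.1 hσ)
  rw [FiniteTensorIntegral] at h
  convert h.ne using 3 with x
  rw [tensorOn, ← enorm_finset_prod, Real.enorm_eq_ofReal_abs, Finset.abs_prod]

theorem ae_integrable_factorialMeasure {ℓ : ℕ} (hℓ : 1 ≤ ℓ)
    (hη : IsPoissonProcess P η (ENNReal.ofReal t • lam)) (hf : Measurable f)
    (hA : ∫⁻ ω, (∫⁻ y, ‖f y‖ₑ ∂(factorialMeasure (η ω) m)) ^ ℓ ∂P ≠ ∞) :
    ∀ᵐ ω ∂P, Integrable f (factorialMeasure (η ω) m) := by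
  have h1 := lintegral_enorm_pow_ne_top hℓ hA
  simp only [pow_one] at h1
  filter_upwards [ae_lt_top' (aemeasurable_lintegral_enorm hη hf) h1] with ω hω
  exact ⟨hf.aestronglyMeasurable, hω⟩

theorem ae_integral_eq_signPart {ℓ : ℕ} (hℓ : 1 ≤ ℓ)
    (hη : IsPoissonProcess P η (ENNReal.ofReal t • lam)) (hf : Measurable f)
    (hA : ∫⁻ ω, (∫⁻ y, ‖f y‖ₑ ∂(factorialMeasure (η ω) m)) ^ ℓ ∂P ≠ ∞) :
    ∀ᵐ ω ∂P, ∫ y, f y ∂(factorialMeasure (η ω) m)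
      = (∫⁻ y, signPart f true y ∂(factorialMeasure (η ω) m)).toReal
        - (∫⁻ y, signPart f false y ∂(factorialMeasure (η ω) m)).toReal := by
  filter_upwards [ae_integrable_factorialMeasure hℓ hη hf hA] with ω hω
  exact integral_eq_lintegral_pos_part_sub_lintegral_neg_part hω

theorem memLp_integral_factorialMeasure {ℓ : ℕ} (hℓ : 1 ≤ ℓ)
    (hη : IsPoissonProcess P η (ENNReal.ofReal t • lam)) (hf : Measurable f)
    (hA : ∫⁻ ω, (∫⁻ y, ‖f y‖ₑ ∂(factorialMeasure (η ω) m)) ^ ℓ ∂P ≠ ∞) :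
    MemLp (fun ω => ∫ y, f y ∂(factorialMeasure (η ω) m)) ℓ P := by
  have := sigmaFinite_ofReal_smul lam t
  refine ⟨?_, ?_⟩
  · refine AEMeasurable.aestronglyMeasurable ?_
    exact ((hη.mecke m _ (measurable_signPart hf true)).1.ennreal_toReal.sub
      (hη.mecke m _ (measurable_signPart hf false)).1.ennreal_toReal).congr
        (EventuallyEq.symm (ae_integral_eq_signPart hℓ hη hf hA))
  · rw [eLpNorm_lt_top_iff_lintegral_rpow_enorm_lt_top (by positivity) (by simp)]
    refine lt_of_le_of_lt (lintegral_mono fun ω => ?_) hA.lt_top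
    simp only [ENNReal.toReal_natCast, ENNReal.rpow_natCast]
    exact pow_le_pow_left' (enorm_integral_le_lintegral_enorm _) ℓ

/-- The moments of order at most `ℓ` of the U-statistic. -/
theorem integral_pow_eq_momentSum {n ℓ : ℕ} (ht : 0 < t) (hℓ : 1 ≤ ℓ) (hn : n ≤ ℓ)
    (hη : IsPoissonProcess P η (ENNReal.ofReal t • lam)) (hf : Measurable f)
    (hA : ∫⁻ ω, (∫⁻ y, ‖f y‖ₑ ∂(factorialMeasure (η ω) m)) ^ ℓ ∂P ≠ ∞) :
    ∫ ω, (∫ y, f y ∂(factorialMeasure (η ω) m)) ^ n ∂P = momentSum (Fin n) lam f t := by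
  classical
  have := sigmaFinite_ofReal_smul lam t
  have hle : ∀ s : Fin n → Bool,
      ∫⁻ ω, ∏ i, ∫⁻ y, signPart f (s i) y ∂(factorialMeasure (η ω) m) ∂P ≠ ∞ := fun s => by
    refine ne_top_of_le_ne_top (lintegral_enorm_pow_ne_top hn hA) (lintegral_mono fun ω => ?_)
    refine (Finset.prod_le_prod' fun i _ => lintegral_mono (signPart_le_enorm f (s i))).trans ?_
    simp
  have hfin := lintegral_partition_ne_top ht hη hf hn hA
  have hfin' : ∀ s : Fin n → Bool, ∀ σ ∈ nonFlat (Fin n) m, ∫⁻ x : Quotient σ → X,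
      ∏ i, signPart f (s i) (fun k => x (Quotient.mk σ ⟨i, k⟩)) ∂(Measure.pi fun _ => lam) ≠ ∞ :=
    fun s σ hσ => ne_top_of_le_ne_top (hfin σ hσ) (lintegral_mono fun x =>
      Finset.prod_le_prod' fun i _ => signPart_le_enorm _ _ _)
  have h1 : ∫ ω, (∫ y, f y ∂(factorialMeasure (η ω) m)) ^ n ∂P = ∫ ω, ∏ _i : Fin n,
      ((∫⁻ y, signPart f true y ∂(factorialMeasure (η ω) m)).toReal
        - (∫⁻ y, signPart f false y ∂(factorialMeasure (η ω) m)).toReal) ∂P := by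
    refine integral_congr_ae ?_
    filter_upwards [ae_integral_eq_signPart hℓ hη hf hA] with ω hω
    simp [hω]
  have h2 : ∀ s : Fin n → Bool,
      (∫⁻ ω, ∏ i, ∫⁻ y, signPart f (s i) y ∂(factorialMeasure (η ω) m) ∂P).toReal
      = ∑ σ ∈ nonFlat (Fin n) m, t ^ Nat.card (Quotient σ) * (∫⁻ x : Quotient σ → X,
        ∏ i, signPart f (s i) (fun k => x (Quotient.mk σ ⟨i, k⟩))
          ∂(Measure.pi fun _ => lam)).toReal := by
    intro s
    rw [hη.lintegral_prod_uStatistic (fun i => signPart f (s i)) fun i => measurable_signPart hf _]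
    simp_rw [pi_ofReal_smul, lintegral_smul_measure, smul_eq_mul]
    rw [ENNReal.toReal_sum fun σ hσ => ENNReal.mul_ne_top (by finiteness) (hfin' s σ hσ)]
    refine Finset.sum_congr rfl fun σ _ => ?_
    rw [ENNReal.toReal_mul, ENNReal.toReal_pow, ENNReal.toReal_ofReal ht.le,
      Nat.card_eq_fintype_card]
  rw [h1, integral_prod_sub_toReal P
    (fun b _ ω => ∫⁻ y, signPart f b y ∂(factorialMeasure (η ω) m))
    (fun b _ => (hη.mecke m _ (measurable_signPart hf b)).1) hle]
  simp_rw [h2, Finset.mul_sum]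
  rw [Finset.sum_comm, momentSum]
  refine Finset.sum_congr rfl fun σ hσ => ?_
  rw [partitionWeight, partitionIntegral_eq_sum_signs lam hf σ (hfin σ hσ), Finset.mul_sum]
  refine Finset.sum_congr rfl fun s _ => ?_
  ring

/-- The central moment of order `n` in terms of the moments `momentSum`; the mean is
`cumulantSum (Fin 1) lam f t`. -/
noncomputable def centralSum (lam : Measure X) (f : (Fin m → X) → ℝ) (t : ℝ) (n : ℕ) : ℝ :=
  ∑ k ∈ Finset.range (n + 1), (n.choose k : ℝ) *
    (momentSum (Fin k) lam f t * (-cumulantSum (Fin 1) lam f t) ^ (n - k))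

theorem integral_sub_pow_eq_centralSum {n ℓ : ℕ} (ht : 0 < t) (hℓ : 1 ≤ ℓ) (hn : n ≤ ℓ)
    (hη : IsPoissonProcess P η (ENNReal.ofReal t • lam)) (hf : Measurable f)
    (hA : ∫⁻ ω, (∫⁻ y, ‖f y‖ₑ ∂(factorialMeasure (η ω) m)) ^ ℓ ∂P ≠ ∞) :
    ∫ ω, ((∫ y, f y ∂(factorialMeasure (η ω) m))
      - ∫ ω', ∫ y, f y ∂(factorialMeasure (η ω') m) ∂P) ^ n ∂P = centralSum lam f t n := by
  have h0 : momentSum (Fin 0) lam f t = 1 := by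
    rw [← integral_pow_eq_momentSum ht hℓ (Nat.zero_le ℓ) hη hf hA]
    simp
  have h1 : ∫ ω', ∫ y, f y ∂(factorialMeasure (η ω') m) ∂P = cumulantSum (Fin 1) lam f t := by
    have h2 := integral_pow_eq_momentSum ht hℓ hℓ hη hf hA
    rw [momentSum_succ lam hf t 0] at h2
    simpa [h0] using h2
  have hU := memLp_integral_factorialMeasure hℓ hη hf hA
  rw [h1]
  simp_rw [sub_eq_add_neg, add_pow]
  rw [integral_finsetSum]
  · rw [centralSum]
    refine Finset.sum_congr rfl fun k hk => ?_
    rw [integral_mul_const, integral_mul_const, integral_pow_eq_momentSum ht hℓ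
      ((Nat.lt_succ_iff.1 (Finset.mem_range.1 hk)).trans hn) hη hf hA]
    ring
  · intro k hk
    refine Integrable.mul_const (Integrable.mul_const ?_ _) _
    have hUk := hU.mono_exponent (p := k) (by
      exact_mod_cast (Nat.lt_succ_iff.1 (Finset.mem_range.1 hk)).trans hn)
    exact hUk.integrable_norm_pow'.mono' (hUk.aestronglyMeasurable.pow k)
      (ae_of_all _ fun ω => (norm_pow _ _).le)

end MomentFormula

/-! ### The limit theorem -/

section Limit

variable {X : Type*} [MeasurableSpace X] {lam : Measure X} [SigmaFinite lam] {m : ℕ}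
  {f : (Fin m → X) → ℝ}

theorem centralSum_zero {lam : Measure X} {t : ℝ} (h0 : momentSum (Fin 0) lam f t = 1) :
    centralSum lam f t 0 = 1 := by
  simp [centralSum, h0]

theorem centralSum_succ (hf : Measurable f) (t : ℝ) (n : ℕ) :
    centralSum lam f t (n + 1) = ∑ j ∈ Finset.range n, (n.choose (j + 1) : ℝ) *
      (cumulantSum (Fin (j + 2)) lam f t * centralSum lam f t (n - (j + 1))) :=
  central_recursion (M := fun n => momentSum (Fin n) lam f t)
    (K := fun n => cumulantSum (Fin n) lam f t) (momentSum_succ lam hf t) (fun _ => rfl) n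

open Classical in
/-- Asymptotic normality in terms of the sums over partitions. It holds for all orders `n`,
whether or not the moments of order `n` exist, since the weights are multiples of powers of `t` in
any case. -/
theorem tendsto_centralSum (hm : 1 ≤ m) (hf : Measurable f)
    (hf_symm : ∀ (e : Equiv.Perm (Fin m)) (x : Fin m → X), f (x ∘ e) = f x)
    (hfin : ∀ σ ∈ nonFlat (Fin 2) m, ∫⁻ x : Quotient σ → X,
      ∏ i, ‖f fun k => x (Quotient.mk σ ⟨i, k⟩)‖ₑ ∂(Measure.pi fun _ => lam) ≠ ∞)
    (hf1 : 0 < eLpNorm (chaosKernel lam f 1) 2 (Measure.pi fun _ => lam))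
    (h0 : ∀ᶠ t in atTop, momentSum (Fin 0) lam f t = 1) :
    (∀ᶠ t in atTop, 0 < cumulantSum (Fin 2) lam f t) ∧
    ∀ n, Tendsto (fun t => centralSum lam f t n / √(cumulantSum (Fin 2) lam f t) ^ n) atTop
      (𝓝 (gaussianMoment n)) := by
  obtain ⟨V, hV, hlim⟩ := exists_tendsto_cumulantSum_two hm lam hf hf_symm hfin hf1
  have hpos : ∀ᶠ t in atTop, 0 < cumulantSum (Fin 2) lam f t := by
    filter_upwards [hlim.eventually_const_lt hV] with t ht
    by_contra hneg
    exact absurd ht (not_lt.2 (div_nonpos_of_nonpos_of_nonneg (not_lt.1 hneg) (by positivity)))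
  have hs : Tendsto (fun t => √(cumulantSum (Fin 2) lam f t) / √t ^ (2 * m - 1)) atTop
      (𝓝 √V) := by
    refine ((Real.continuous_sqrt.tendsto V).comp hlim).congr fun t => ?_
    rw [Function.comp_apply, Real.sqrt_div' _ (by positivity), Real.sqrt_sq (by positivity)]
  have hsV : √V ≠ 0 := (Real.sqrt_pos.2 hV).ne'
  have hconv : ∀ n c, Tendsto (fun t => cumulantSum (Fin n) lam f t / (√t ^ (2 * m - 1)) ^ n) atTop
      (𝓝 c) → Tendsto (fun t => cumulantSum (Fin n) lam f t
        / √(cumulantSum (Fin 2) lam f t) ^ n) atTop (𝓝 (c / √V ^ n)) := by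
    intro n c hc
    refine (hc.div (hs.pow n) (pow_ne_zero n hsV)).congr' ?_
    filter_upwards [eventually_gt_atTop 0] with t ht
    have : √t ^ (2 * m - 1) ≠ 0 := pow_ne_zero _ (Real.sqrt_pos.2 ht).ne'
    rw [Pi.div_apply, div_pow, div_div_div_cancel_right₀ (pow_ne_zero n this)]
  refine ⟨hpos, tendsto_central_moments (K := fun t n => cumulantSum (Fin n) lam f t)
    (h0.mono fun t => centralSum_zero) (Eventually.of_forall fun t n => centralSum_succ hf t n)
    ?_ fun n hn => ?_⟩
  · have := hconv 2 V hlim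
    rwa [Real.sq_sqrt hV.le, div_self hV.ne'] at this
  · simpa using hconv n 0 (tendsto_cumulantSum_of_three_le lam f hn)

/-- The sign of the factor `g t` is irrelevant, because the odd moments tend to zero. -/
theorem tendsto_sign_mul {h u : ℝ → ℝ} {n : ℕ} {l : Filter ℝ}
    (hh : ∀ᶠ t in l, h t ≠ 0) (hu : Tendsto u l (𝓝 (gaussianMoment n))) :
    Tendsto (fun t => (h t / |h t|) ^ n * u t) l (𝓝 (gaussianMoment n)) := by
  have habs : ∀ᶠ t in l, |(h t / |h t|)| = 1 := hh.mono fun t ht => by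
    rw [abs_div, abs_abs, div_self (abs_ne_zero.2 ht)]
  rcases Nat.even_or_odd n with hn | hn
  · refine hu.congr' ?_
    filter_upwards [habs] with t ht
    rw [← hn.pow_abs, ht, one_pow, one_mul]
  · have h0 : gaussianMoment n = 0 := by rw [gaussianMoment, if_neg (Nat.not_even_iff_odd.2 hn)]
    rw [h0] at hu ⊢
    rw [tendsto_zero_iff_abs_tendsto_zero] at hu ⊢
    refine hu.congr' ?_
    filter_upwards [habs] with t ht
    simp only [Function.comp_apply]
    rw [abs_mul, abs_pow, ht, one_pow, one_mul]

end Limit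

end PoissonU

theorem corollaryc3 {Ω X : Type*} [MeasurableSpace Ω] [MeasurableSpace X]
    (P : Measure Ω) [IsProbabilityMeasure P] (lam : Measure X) [SigmaFinite lam]
    (η : ℝ → Ω → Measure X)
    (hη : ∀ t : ℝ, 0 < t → PoissonU.IsPoissonProcess P (η t) (ENNReal.ofReal t • lam))
    (m : ℕ) (hm : 1 ≤ m) (f : (Fin m → X) → ℝ) (hf_meas : Measurable f)
    (hf_symm : ∀ (e : Equiv.Perm (Fin m)) (x : Fin m → X), f (x ∘ e) = f x)
    (hf_int : Integrable f (Measure.pi fun _ => lam))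
    (g : ℝ → ℝ) (hg : ∀ᶠ t in atTop, g t ≠ 0)
    (F : ℝ → Ω → ℝ) (hF : ∀ t ω, F t ω = PoissonU.uStatistic (g t) f (η t ω))
    (ℓ : ℕ) (hℓ : 1 ≤ ℓ)
    (hint : ∀ σ ∈ PoissonU.nonFlatPartitions (fun _ : Fin ℓ => m),
      PoissonU.FiniteTensorIntegral lam (fun _ : Fin ℓ => f) σ)
    (hf1 : 0 < eLpNorm (PoissonU.chaosKernel lam f 1) 2 (Measure.pi fun _ => lam)) :
    (∀ t : ℝ, 0 < t →
      (∀ᵐ ω ∂P, Integrable f (PoissonU.factorialMeasure (η t ω) m)) ∧ MemLp (F t) ℓ P) ∧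
    (2 ≤ ℓ → ∀ᶠ t in atTop, 0 < Var[F t; P]) ∧
    Tendsto (fun t : ℝ => (∫ ω, (F t ω - P[F t]) ^ ℓ ∂P) / Var[F t; P] ^ ((ℓ : ℝ) / 2)) atTop
      (𝓝 (if Even ℓ then (Nat.doubleFactorial (ℓ - 1) : ℝ) else 0)) ∧
    Tendsto (fun t : ℝ =>
        PoissonU.cumulant P ℓ (fun ω => (F t ω - P[F t]) / Real.sqrt Var[F t; P])) atTop
      (𝓝 (if ℓ = 2 then (1 : ℂ) else 0)) := by
  classical
  have hA : ∀ t : ℝ, 0 < t →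
      ∫⁻ ω, (∫⁻ y, ‖f y‖ₑ ∂(PoissonU.factorialMeasure (η t ω) m)) ^ ℓ ∂P ≠ ∞ := fun t ht =>
    PoissonU.lintegral_enorm_pow_ne_top_of_finiteTensorIntegral (hη t ht) hf_meas hint
  have hFU : ∀ t, F t = fun ω => g t * ∫ y, f y ∂(PoissonU.factorialMeasure (η t ω) m) :=
    fun t => funext fun ω => hF t ω
  have hLp : ∀ t : ℝ, 0 < t → MemLp (F t) ℓ P := fun t ht => by
    rw [hFU]
    exact (PoissonU.memLp_integral_factorialMeasure hℓ (hη t ht) hf_meas (hA t ht)).const_mul _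
  have hcentral : ∀ t : ℝ, 0 < t → ∀ n ≤ ℓ,
      ∫ ω, (F t ω - P[F t]) ^ n ∂P = g t ^ n * PoissonU.centralSum lam f t n := by
    intro t ht n hn
    rw [hFU, ← PoissonU.integral_sub_pow_eq_centralSum ht hℓ hn (hη t ht) hf_meas (hA t ht),
      ← integral_const_mul, integral_const_mul]
    simp_rw [← mul_sub, mul_pow]
  have h0 : ∀ t : ℝ, 0 < t → PoissonU.momentSum (Fin 0) lam f t = 1 := fun t ht => by
    rw [← PoissonU.integral_pow_eq_momentSum ht hℓ (Nat.zero_le ℓ) (hη t ht) hf_meas (hA t ht)]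
    simp
  have hfin : ∀ n ≤ ℓ, ∀ σ ∈ PoissonU.nonFlat (Fin n) m, ∫⁻ x : Quotient σ → X,
      ∏ i, ‖f fun k => x (Quotient.mk σ ⟨i, k⟩)‖ₑ ∂(Measure.pi fun _ => lam) ≠ ∞ := fun n hn =>
    PoissonU.lintegral_partition_ne_top one_pos (hη 1 one_pos) hf_meas hn (hA 1 one_pos)
  have hvar : 2 ≤ ℓ → ∀ t : ℝ, 0 < t →
      Var[F t; P] = g t ^ 2 * PoissonU.cumulantSum (Fin 2) lam f t := by
    intro h2 t ht
    rw [variance_eq_integral (hLp t ht).aemeasurable, hcentral t ht 2 h2,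
      PoissonU.centralSum_succ hf_meas t 1]
    simp [PoissonU.centralSum_zero (h0 t ht)]
  -- the integrability assumption for two rows requires `2 ≤ ℓ`
  have hlim : 2 ≤ ℓ → _ := fun h2 => PoissonU.tendsto_centralSum hm hf_meas hf_symm (hfin 2 h2) hf1
    ((eventually_gt_atTop 0).mono h0)
  -- the moments of the standardized U-statistic
  have hmom : ∀ n ≤ ℓ, Tendsto
      (fun t : ℝ => ∫ ω, ((F t ω - P[F t]) / √Var[F t; P]) ^ n ∂P) atTop
      (𝓝 (PoissonU.gaussianMoment n)) := by
    intro n hn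
    rcases Nat.lt_or_ge ℓ 2 with h1 | h2
    -- for `ℓ = 1` only the orders `0` and `1` occur, and the value of the variance is irrelevant
    · refine tendsto_const_nhds.congr' ?_
      filter_upwards [eventually_gt_atTop 0] with t ht
      simp_rw [div_pow]
      rw [integral_div, hcentral t ht n hn]
      obtain rfl | rfl : n = 0 ∨ n = 1 := by omega
      · simp [PoissonU.gaussianMoment_zero, PoissonU.centralSum_zero (h0 t ht)]
      · rw [PoissonU.centralSum_succ hf_meas t 0]
        simp [PoissonU.gaussianMoment_one]
    · refine (PoissonU.tendsto_sign_mul hg ((hlim h2).2 n)).congr' ?_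
      filter_upwards [eventually_gt_atTop 0] with t ht
      simp_rw [div_pow]
      rw [integral_div, hcentral t ht n hn, hvar h2 t ht, Real.sqrt_mul (sq_nonneg _),
        Real.sqrt_sq_eq_abs, mul_pow, div_mul_div_comm]
  refine ⟨fun t ht => ⟨PoissonU.ae_integrable_factorialMeasure hℓ (hη t ht) hf_meas (hA t ht),
    hLp t ht⟩, fun h2 => ?_, ?_, ?_⟩
  · filter_upwards [eventually_gt_atTop 0, hg, (hlim h2).1] with t ht hgt hK
    rw [hvar h2 t ht]
    positivity
  · refine (hmom ℓ le_rfl).congr fun t => ?_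
    simp_rw [div_pow]
    rw [integral_div, Real.sqrt_eq_rpow, ← Real.rpow_natCast (_ ^ _) ℓ,
      ← Real.rpow_mul (variance_nonneg _ _), one_div_mul_eq_div]
  · refine PoissonU.tendsto_cumulant (P := P) (ℓ := ℓ) ?_ hmom ℓ hℓ le_rfl
    filter_upwards [eventually_gt_atTop 0] with t ht
    simp_rw [div_eq_mul_inv]
    exact ((hLp t ht).sub (memLp_const _)).mul_const _
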